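/- Let $(M,g)$ be a closed (compact, without boundary), connected smooth Riemannian manifold and let $\sigma\in\Omega^2(M)$ be a smooth closed two-form. Let $\nabla$ be the Levi-Civita connection of $g$ and let $Y\colon TM\to TM$ be the Lorentz force, defined by $g_q(Y_qu,v)=\sigma_q(u,v)$ for all $q\in M$ and $u,v\in T_qM$. A magnetic geodesic is a smooth curve $\gamma\colon J\to M$ on an open interval $J$ with $\nabla_{\dot\gamma}\dot\gamma=Y_\gamma\dot\gamma$. An embedded submanifold $N\subseteq M$ is called totally magnetic if for every magnetic geodesic $\gamma\colon J\to M$ with $0\in J$, $\gamma(0)\in N$ and $\dot\gamma(0)\in T_{\gamma(0)}N$ there exists $\varepsilon>0$ such that $(-\varepsilon,\varepsilon)\subseteq J$ and $\gamma((-\varepsilon,\varepsilon))\subseteq N$. A magnetomorphism of $(M,g,\sigma)$ is a smooth diffeomorphism $F\colon M\to M$ with $F^*g=g$ and $F^*\sigma=\sigma$. Let $\mathcal M$ be any set of magnetomorphisms of $(M,g,\sigma)$. Then each connected component of the common fixed-point set $$\mathrm{Fix}(\mathcal M)=\{p\in M : F(p)=p \text{ for all } F\in\mathcal M\}$$ is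 a totally magnetic submanifold of $(M,g,\sigma)$; in particular it is an embedded submanifold of $M$. -/

import Mathlib

open Set Bundle
open scoped Manifold ContDiff Topology

namespace Magnetic

noncomputable section

/-- The model space `ℝⁿ`. -/
abbrev Model (n : ℕ) : Type := EuclideanSpace ℝ (Fin n)

/-- A smooth Riemannian metric on the smooth manifold `M`. -/
abbrev Metric (n : ℕ) (M : Type*) [TopologicalSpace M] [ChartedSpace (Model n) M]
    [IsManifold (𝓡 n) ∞ M] : Type _ :=
  ContMDiffRiemannianMetric (𝓡 n) ∞ (Model n) (TangentSpace (𝓡 n) : M → Type _)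

section Forms

variable {n : ℕ} {M : Type*} [TopologicalSpace M] [ChartedSpace (Model n) M]
  [IsManifold (𝓡 n) ∞ M]

/-- A vector field `X` on `M` is smooth. -/
def IsSmoothVectorField (X : ∀ x : M, TangentSpace (𝓡 n) x) : Prop :=
  ContMDiff (𝓡 n) (𝓡 n).tangent ∞ (fun x ↦ (⟨x, X x⟩ : TangentBundle (𝓡 n) M))

/-- The function `dσ(X, Y, Z)` of a `2`-form `σ` and vector fields `X`, `Y`, `Z`:
`X σ(Y,Z) - Y σ(X,Z) + Z σ(X,Y) - σ([X,Y],Z) + σ([X,Z],Y) - σ([Y,Z],X)`. -/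
def extDerivTwoForm
    (σ : ∀ x : M, TangentSpace (𝓡 n) x →L[ℝ] TangentSpace (𝓡 n) x →L[ℝ] ℝ)
    (X Y Z : ∀ x : M, TangentSpace (𝓡 n) x) (x : M) : ℝ :=
  mvfderiv (𝓡 n) (fun y ↦ σ y (Y y) (Z y)) x (X x)
    - mvfderiv (𝓡 n) (fun y ↦ σ y (X y) (Z y)) x (Y x)
    + mvfderiv (𝓡 n) (fun y ↦ σ y (X y) (Y y)) x (Z x)
    - σ x (VectorField.mlieBracket (𝓡 n) X Y x) (Z x)
    + σ x (VectorField.mlieBracket (𝓡 n) X Z x) (Y x)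
    - σ x (VectorField.mlieBracket (𝓡 n) Y Z x) (X x)

end Forms

/-- A magnetic system `(M, g, σ)`: a Riemannian metric `g` and a smooth closed `2`-form `σ`. -/
structure MagneticSystem (n : ℕ) (M : Type*) [TopologicalSpace M] [ChartedSpace (Model n) M]
    [IsManifold (𝓡 n) ∞ M] where
  /-- The Riemannian metric `g`. -/
  metric : Metric n M
  /-- The magnetic field `σ`. -/
  form : ∀ x : M, TangentSpace (𝓡 n) x →L[ℝ] TangentSpace (𝓡 n) x →L[ℝ] ℝ
  form_self : ∀ (x : M) (v : TangentSpace (𝓡 n) x), form x v v = 0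
  form_smooth : ContMDiff (𝓡 n) ((𝓡 n).prod 𝓘(ℝ, Model n →L[ℝ] Model n →L[ℝ] ℝ)) ∞
    (fun x ↦ TotalSpace.mk' (Model n →L[ℝ] Model n →L[ℝ] ℝ) x (form x))
  form_closed : ∀ X Y Z : ∀ x : M, TangentSpace (𝓡 n) x,
    IsSmoothVectorField X → IsSmoothVectorField Y → IsSmoothVectorField Z →
      ∀ x : M, extDerivTwoForm form X Y Z x = 0

variable {n : ℕ} {M : Type*} [TopologicalSpace M] [ChartedSpace (Model n) M]

/-! ### The Levi-Civita connection in charts -/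

section Charts

variable [IsManifold (𝓡 n) ∞ M]

/-- The coordinate vector `∂ᵢ` of the chart `e`, at the point of `M` with coordinates `y`. -/
def coordVec (e : OpenPartialHomeomorph M (Model n)) (y : Model n) (i : Fin n) :
    TangentSpace (𝓡 n) (e.symm y) :=
  mfderiv (𝓡 n) (𝓡 n) e.symm y (EuclideanSpace.single i (1 : ℝ) : Model n)

/-- The matrix `gᵢⱼ` of the metric in the chart `e`, as a function of the coordinates. -/
def gram (g : Metric n M) (e : OpenPartialHomeomorph M (Model n)) (y : Model n) :
    Matrix (Fin n) (Fin n) ℝ :=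
  Matrix.of fun i j ↦ g.inner (e.symm y) (coordVec e y i) (coordVec e y j)

/-- The partial derivative `∂ᵢ gⱼₗ` in the chart `e`. -/
def dGram (g : Metric n M) (e : OpenPartialHomeomorph M (Model n)) (i j l : Fin n)
    (y : Model n) : ℝ :=
  fderiv ℝ (fun z ↦ gram g e z j l) y (EuclideanSpace.single i (1 : ℝ))

/-- The Christoffel symbol `Γᵏᵢⱼ = ½ ∑ₗ gᵏˡ (∂ᵢ gⱼₗ + ∂ⱼ gᵢₗ - ∂ₗ gᵢⱼ)` of the Levi-Civita
connection in the chart `e`. -/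
def christoffel (g : Metric n M) (e : OpenPartialHomeomorph M (Model n)) (k i j : Fin n)
    (y : Model n) : ℝ :=
  1 / 2 * ∑ l, (gram g e y)⁻¹ k l *
    (dGram g e i j l y + dGram g e j i l y - dGram g e l i j y)

/-- The components in the chart `e` of the covariant acceleration `∇_γ' γ'` at time `t`:
`(γᵏ)'' + ∑ᵢⱼ Γᵏᵢⱼ (γⁱ)' (γʲ)'`. -/
def covAccel (g : Metric n M) (e : OpenPartialHomeomorph M (Model n)) (γ : ℝ → M) (t : ℝ) :
    Model n :=
  WithLp.toLp 2 fun k ↦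
    deriv (deriv fun s ↦ e (γ s) k) t
      + ∑ i, ∑ j, christoffel g e k i j (e (γ t))
          * deriv (fun s ↦ e (γ s) i) t * deriv (fun s ↦ e (γ s) j) t

end Charts

/-! ### Submanifolds -/

/-- The velocity of a curve, as a point of the tangent bundle. -/
def velocity (γ : ℝ → M) (t : ℝ) : TangentBundle (𝓡 n) M :=
  ⟨γ t, mfderiv 𝓘(ℝ, ℝ) (𝓡 n) γ t (1 : ℝ)⟩

/-- `N ⊆ M` is an embedded submanifold (of some dimension `k`, without boundary): around each of
its points there is a slice chart of `M`, in which `N` is a `k`-dimensional linear subspace. -/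
def IsEmbeddedSubmanifold (N : Set M) : Prop :=
  ∃ k : ℕ, ∀ p ∈ N, ∃ e ∈ IsManifold.maximalAtlas (𝓡 n) ∞ M, p ∈ e.source ∧
    ∃ W : Submodule ℝ (Model n), Module.finrank ℝ W = k ∧
      ∀ x ∈ e.source, x ∈ N ↔ e x ∈ W

/-- The tangent bundle `TN ⊆ TM` of a submanifold `N`: all velocities at time `0` of smooth
curves of `M` that stay in `N`. -/
def tangentVectors (N : Set M) : Set (TangentBundle (𝓡 n) M) :=
  {v | ∃ c : ℝ → M, ∃ ε > (0 : ℝ), ContMDiffOn 𝓘(ℝ, ℝ) (𝓡 n) ∞ c (Ioo (-ε) ε) ∧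
    (∀ t ∈ Ioo (-ε) ε, c t ∈ N) ∧ velocity c 0 = v}

/-- The common fixed points of a set of diffeomorphisms of `M`. -/
def fixedPoints (𝓜 : Set (M ≃ₘ⟮𝓡 n, 𝓡 n⟯ M)) : Set M :=
  {p | ∀ F ∈ 𝓜, F p = p}

/-! ### Magnetic geodesics, magnetomorphisms, totally magnetic submanifolds -/

namespace MagneticSystem

variable [IsManifold (𝓡 n) ∞ M] (S : MagneticSystem n M)

instance (x : M) : FiniteDimensional ℝ (TangentSpace (𝓡 n) x) :=
  inferInstanceAs (FiniteDimensional ℝ (Model n))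

/-- The metric at `x` as a bilinear form. -/
def metricForm (x : M) : LinearMap.BilinForm ℝ (TangentSpace (𝓡 n) x) :=
  LinearMap.mk₂ ℝ (fun u v ↦ S.metric.inner x u v) (by simp) (by simp) (by simp) (by simp)

/-- The magnetic field at `x` as a bilinear form. -/
def fieldForm (x : M) : LinearMap.BilinForm ℝ (TangentSpace (𝓡 n) x) :=
  LinearMap.mk₂ ℝ (fun u v ↦ S.form x u v) (by simp) (by simp) (by simp) (by simp)

theorem metricForm_nondegenerate (x : M) : (S.metricForm x).Nondegenerate := by
  have key : ∀ v : TangentSpace (𝓡 n) x, S.metric.inner x v v = 0 → v = 0 := by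
    intro v hv
    by_contra h
    exact absurd hv (S.metric.pos x v h).ne'
  exact ⟨fun v h ↦ key v (h v), fun v h ↦ key v (h v)⟩

/-- The Lorentz force `Yₓ : TₓM → TₓM`, determined by `g(Y u, v) = σ(u, v)`. -/
def lorentzForce (x : M) : TangentSpace (𝓡 n) x →ₗ[ℝ] TangentSpace (𝓡 n) x :=
  ((S.metricForm x).toDual (S.metricForm_nondegenerate x)).symm.toLinearMap ∘ₗ S.fieldForm x

theorem metric_lorentzForce (x : M) (u v : TangentSpace (𝓡 n) x) :
    S.metric.inner x (S.lorentzForce x u) v = S.form x u v :=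
  LinearMap.BilinForm.apply_toDual_symm_apply (B := S.metricForm x)
    (hB := S.metricForm_nondegenerate x) (S.fieldForm x u) v

/-- `γ` is a magnetic geodesic on the open set `J ⊆ ℝ`: it is smooth on `J` and satisfies
`∇_γ' γ' = Y γ'` there. Both sides are vectors of `TM`, so the equation does not depend on the chart; it is
written in components in the smooth charts around the point considered. -/
def IsMagneticGeodesicOn (γ : ℝ → M) (J : Set ℝ) : Prop :=
  ContMDiffOn 𝓘(ℝ, ℝ) (𝓡 n) ∞ γ J ∧
    ∀ t ∈ J, ∀ e ∈ IsManifold.maximalAtlas (𝓡 n) ∞ M, γ t ∈ e.source →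
      covAccel S.metric e γ t =
        mfderiv (𝓡 n) (𝓡 n) e (γ t)
          (S.lorentzForce (γ t) (mfderiv 𝓘(ℝ, ℝ) (𝓡 n) γ t (1 : ℝ)))

/-- The magnetomorphisms `Mag(M, g, σ)`: diffeomorphisms `F` with `F^*g = g` and `F^*σ = σ`. -/
def Mag : Set (M ≃ₘ⟮𝓡 n, 𝓡 n⟯ M) :=
  {F | ∀ (x : M) (u v : TangentSpace (𝓡 n) x),
    S.metric.inner (F x) (mfderiv (𝓡 n) (𝓡 n) F x u) (mfderiv (𝓡 n) (𝓡 n) F x v)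
        = S.metric.inner x u v ∧
    S.form (F x) (mfderiv (𝓡 n) (𝓡 n) F x u) (mfderiv (𝓡 n) (𝓡 n) F x v)
        = S.form x u v}

/-- `N` is a totally magnetic submanifold: an embedded submanifold such that each magnetic
geodesic `γ : J → M` (`J` an open interval around `0`) with `γ'(0) ∈ TN` stays in `N` for small
time. -/
def IsTotallyMagnetic (N : Set M) : Prop :=
  IsEmbeddedSubmanifold (n := n) N ∧
    ∀ (γ : ℝ → M) (J : Set ℝ), IsOpen J → J.OrdConnected → (0 : ℝ) ∈ J →
      S.IsMagneticGeodesicOn γ J → γ 0 ∈ N → velocity (n := n) γ 0 ∈ tangentVectors N →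
        ∃ ε > (0 : ℝ), Ioo (-ε) ε ⊆ J ∧ ∀ t ∈ Ioo (-ε) ε, γ t ∈ N

end MagneticSystem

end

end Magnetic

/-! The equation of magnetic geodesics is invariant under magnetomorphisms, and its solutions are
determined by initial position and velocity. Hence a solution whose initial position and velocity
are fixed by every `F ∈ 𝓜` agrees with all its images and consists of common fixed points. Both
halves of the theorem rest on this (`MagneticSystem.IsMagneticCurveOn.fixed`).

Submanifold: let `p` be a common fixed point and `W` the space of vectors fixed by all differentials
at `p`. Straightening coordinates `h` with derivative the identity at `p` send nearby fixed points
into `W` (`exists_straightening`). For the converse, the magnetic exponential map at a small time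
`T` takes small vectors of `W` to fixed points. The equation is not homogeneous in the velocity, so
velocities cannot be rescaled to reach time one; instead `(p, 0)` is an equilibrium of the first
order system, which gives a uniform existence time for small velocities (`exists_secondOrder_exp`).
In the coordinates `h` the time-`T` map sends a small ball of `W` into `W` and is Lipschitz close to
multiplication by `T`, so it covers a ball of `W` (`exists_ball_subset_image`). No differentiability
of the exponential map is needed. Thus the fixed set is exactly `W` in suitable coordinates
(`exists_slice_chart`); it is connected inside this chart, so its component through `p` has the same
slice there, and the slice dimension is constant along a component.

Totally magnetic: a vector tangent to a set of fixed points is fixed by the differentials, so a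
magnetic geodesic issuing in this direction stays in the fixed set. Its image is connected and
therefore stays in the component.

The equation is handled as the vanishing of the covector `g(∇_γ' γ', ·) - σ(γ', ·)`, which involves
only first derivatives of the metric and transforms without Christoffel symbols. These enter only
when the definition of magnetic geodesics is translated into this form. -/

namespace Magnetic

noncomputable section

/-! ### The magnetic equation on an open set of a vector space -/

section Coordinates

variable {E : Type*} [NormedAddCommGroup E] [NormedSpace ℝ E]

section Shortcuts

set_option synthInstance.maxHeartbeats 200000

instance : NormedAddCommGroup (E →L[ℝ] ℝ) := ContinuousLinearMap.toNormedAddCommGroup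
instance : NormedSpace ℝ (E →L[ℝ] ℝ) := ContinuousLinearMap.toNormedSpace
instance : NormedAddCommGroup (E →L[ℝ] E →L[ℝ] ℝ) := ContinuousLinearMap.toNormedAddCommGroup
instance : NormedSpace ℝ (E →L[ℝ] E →L[ℝ] ℝ) := ContinuousLinearMap.toNormedSpace
instance : NormedAddCommGroup (E →L[ℝ] E →L[ℝ] E →L[ℝ] ℝ) :=
  ContinuousLinearMap.toNormedAddCommGroup
instance : NormedSpace ℝ (E →L[ℝ] E →L[ℝ] E →L[ℝ] ℝ) := ContinuousLinearMap.toNormedSpace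
instance : NormedAddCommGroup ((E →L[ℝ] ℝ) →L[ℝ] E) := ContinuousLinearMap.toNormedAddCommGroup
instance : NormedSpace ℝ ((E →L[ℝ] ℝ) →L[ℝ] E) := ContinuousLinearMap.toNormedSpace
instance : NormedAddCommGroup ((E →L[ℝ] E →L[ℝ] ℝ) →L[ℝ] E →L[ℝ] ℝ) :=
  ContinuousLinearMap.toNormedAddCommGroup
instance : NormedSpace ℝ ((E →L[ℝ] E →L[ℝ] ℝ) →L[ℝ] E →L[ℝ] ℝ) :=
  ContinuousLinearMap.toNormedSpace

end Shortcuts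

/-- The covector `g(∇_γ' γ', ·) - σ(γ', ·)` at a point `x` of a coordinate domain, where
`u` and `b` are the first and second derivatives of the curve `γ` and `G`, `s` are the
metric and the magnetic field in coordinates. -/
def magneticResidual (G s : E → E →L[ℝ] E →L[ℝ] ℝ) (x u b w : E) : ℝ :=
  G x b w + fderiv ℝ G x u u w - 1 / 2 * fderiv ℝ G x w u u - s x u w

/-- Differentiating the isometry identity `hG` expresses the derivative of `G` through that of `G'`
and the second derivative of `ψ`. In the combination forming the residual, the second derivatives
cancel except for the one that corrects the acceleration of the image curve. -/
theorem magneticResidual_map {G s G' s' : E → E →L[ℝ] E →L[ℝ] ℝ} {ψ : E → E} {x : E}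
    (hψ : ContDiffAt ℝ 2 ψ x) (hG' : DifferentiableAt ℝ G' (ψ x))
    (hsymm : ∀ u v, G' (ψ x) u v = G' (ψ x) v u)
    (hG : ∀ᶠ z in 𝓝 x, ∀ u v, G' (ψ z) (fderiv ℝ ψ z u) (fderiv ℝ ψ z v) = G z u v)
    (hGd : DifferentiableAt ℝ G x)
    (hs : ∀ u v, s' (ψ x) (fderiv ℝ ψ x u) (fderiv ℝ ψ x v) = s x u v) (u b w : E) :
    magneticResidual G' s' (ψ x) (fderiv ℝ ψ x u)
      (fderiv ℝ ψ x b + fderiv ℝ (fderiv ℝ ψ) x u u) (fderiv ℝ ψ x w) =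
      magneticResidual G s x u b w := by
  have hψ1 : DifferentiableAt ℝ ψ x := hψ.differentiableAt (by norm_num)
  have hψ2 : DifferentiableAt ℝ (fderiv ℝ ψ) x :=
    (hψ.fderiv_right (m := 1) (by norm_num)).differentiableAt (by norm_num)
  have hsym2 : ∀ u v, fderiv ℝ (fderiv ℝ ψ) x u v = fderiv ℝ (fderiv ℝ ψ) x v u := fun u v ↦
    (hψ.isSymmSndFDerivAt (by simp)).eq u v
  have key : ∀ a u v, fderiv ℝ G x a u v =
      fderiv ℝ G' (ψ x) (fderiv ℝ ψ x a) (fderiv ℝ ψ x u) (fderiv ℝ ψ x v)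
      + G' (ψ x) (fderiv ℝ (fderiv ℝ ψ) x a u) (fderiv ℝ ψ x v)
      + G' (ψ x) (fderiv ℝ ψ x u) (fderiv ℝ (fderiv ℝ ψ) x a v) := by
    intro a u v
    have h1 : HasFDerivAt (fun z ↦ G z u v)
        (((ContinuousLinearMap.apply ℝ ℝ v).comp (ContinuousLinearMap.apply ℝ (E →L[ℝ] ℝ) u)).comp
          (fderiv ℝ G x)) x :=
      (((ContinuousLinearMap.apply ℝ ℝ v).comp
        (ContinuousLinearMap.apply ℝ (E →L[ℝ] ℝ) u)).hasFDerivAt).comp x hGd.hasFDerivAt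
    have hA : HasFDerivAt (fun z ↦ G' (ψ z)) ((fderiv ℝ G' (ψ x)).comp (fderiv ℝ ψ x)) x :=
      hG'.hasFDerivAt.comp x hψ1.hasFDerivAt
    have hB : ∀ u, HasFDerivAt (fun z ↦ fderiv ℝ ψ z u)
        ((ContinuousLinearMap.apply ℝ E u).comp (fderiv ℝ (fderiv ℝ ψ) x)) x := fun u ↦
      ((ContinuousLinearMap.apply ℝ E u).hasFDerivAt).comp x hψ2.hasFDerivAt
    have h2 := ((hA.clm_apply (hB u)).clm_apply (hB v)).congr_of_eventuallyEq
      (f₁ := fun z ↦ G z u v) (hG.mono fun z hz ↦ (hz u v).symm)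
    have h3 := congrArg (fun L : E →L[ℝ] ℝ ↦ L a) (h1.unique h2)
    simp at h3
    rw [h3]; ring
  have hGx := hG.self_of_nhds
  unfold magneticResidual
  -- By symmetry of `G'` and of the second derivative, the two terms that pair `ψ''(w, u)` with `ψ'
  -- u`, weighted by one half, add up to cancel the term pairing `ψ' u` with `ψ''(u, w)`. What
  -- remains is `G' (ψ''(u, u)) (ψ' w)`.
  rw [key, key, hs, ← hGx b w, hsym2 w u,
    hsymm (fderiv ℝ (fderiv ℝ ψ) x u w) (fderiv ℝ ψ x u)]
  simp only [map_add, add_apply]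
  ring

/-- The acceleration prescribed by the equation of magnetic geodesics in coordinates. -/
def magneticAccel (G s : E → E →L[ℝ] E →L[ℝ] ℝ) (z : E × E) : E :=
  (G z.1).inverse (s z.1 z.2 - fderiv ℝ G z.1 z.2 z.2
    + (1 / 2 : ℝ) • ((ContinuousLinearMap.apply ℝ ℝ z.2).comp
        ((ContinuousLinearMap.apply ℝ (E →L[ℝ] ℝ) z.2).comp (fderiv ℝ G z.1))))

theorem magneticAccel_zero (G s : E → E →L[ℝ] E →L[ℝ] ℝ) (x : E) :
    magneticAccel G s (x, 0) = 0 := by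
  have : (s x 0 - fderiv ℝ G x 0 0 + (1 / 2 : ℝ) • ((ContinuousLinearMap.apply ℝ ℝ (0 : E)).comp
        ((ContinuousLinearMap.apply ℝ (E →L[ℝ] ℝ) (0 : E)).comp (fderiv ℝ G x)))) = 0 := by
    ext w
    simp
  unfold magneticAccel
  dsimp only
  rw [this, map_zero]

/-- Raising the index with the invertible metric solves the covector equation for the acceleration,
which makes it an ordinary differential equation. -/
theorem magneticResidual_eq_zero_iff {G s : E → E →L[ℝ] E →L[ℝ] ℝ} {x : E}
    (hG : (G x).IsInvertible) (u b : E) :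
    (∀ w, magneticResidual G s x u b w = 0) ↔ b = magneticAccel G s (x, u) := by
  obtain ⟨Φ, hΦ⟩ := hG
  have h1 : b = magneticAccel G s (x, u) ↔ G x b = (s x u - fderiv ℝ G x u u
    + (1 / 2 : ℝ) • ((ContinuousLinearMap.apply ℝ ℝ u).comp
        ((ContinuousLinearMap.apply ℝ (E →L[ℝ] ℝ) u).comp (fderiv ℝ G x)))) := by
    simp only [magneticAccel, ← hΦ, ContinuousLinearMap.inverse_equiv]
    exact Φ.eq_symm_apply
  rw [h1, ContinuousLinearMap.ext_iff]
  refine forall_congr' fun w ↦ ?_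
  simp [magneticResidual]
  constructor <;> intro h <;> linarith

theorem isInvertible_of_posDef [FiniteDimensional ℝ E] {B : E →L[ℝ] E →L[ℝ] ℝ}
    (hB : ∀ v, v ≠ 0 → 0 < B v v) : B.IsInvertible := by
  have hinj : Function.Injective B.toLinearMap := by
    rw [← LinearMap.ker_eq_bot, LinearMap.ker_eq_bot']
    intro v hv
    by_contra h
    have := hB v h
    rw [show B v = 0 from hv] at this
    simp at this
  have hdim : Module.finrank ℝ E = Module.finrank ℝ (E →L[ℝ] ℝ) := by
    rw [← (LinearMap.toContinuousLinearMap (𝕜 := ℝ) (E := E) (F' := ℝ)).finrank_eq]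
    exact (Subspace.dual_finrank_eq (K := ℝ) (V := E)).symm
  exact ⟨(LinearEquiv.ofInjectiveOfFinrankEq B.toLinearMap hinj hdim).toContinuousLinearEquiv, by
    ext; rfl⟩

theorem contDiffAt_magneticAccel [CompleteSpace E] {G s : E → E →L[ℝ] E →L[ℝ] ℝ} {Ω : Set E}
    (hΩ : IsOpen Ω) (hG : ContDiffOn ℝ ∞ G Ω) (hs : ContDiffOn ℝ ∞ s Ω)
    (hinv : ∀ x ∈ Ω, (G x).IsInvertible) {z : E × E} (hz : z.1 ∈ Ω) :
    ContDiffAt ℝ ∞ (magneticAccel G s) z := by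
  have hGz : ContDiffAt ℝ ∞ G z.1 := hG.contDiffAt (hΩ.mem_nhds hz)
  have hGc : ContDiffAt ℝ ∞ (fun z : E × E ↦ G z.1) z := hGz.comp z contDiffAt_fst
  have hsc : ContDiffAt ℝ ∞ (fun z : E × E ↦ s z.1) z :=
    (hs.contDiffAt (hΩ.mem_nhds hz)).comp z contDiffAt_fst
  have hdc : ContDiffAt ℝ ∞ (fun z : E × E ↦ fderiv ℝ G z.1) z :=
    (hGz.fderiv_right (m := ∞) (by simp)).comp z contDiffAt_fst
  have h2 : ContDiffAt ℝ ∞ (fun z : E × E ↦ z.2) z := contDiffAt_snd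
  have happ : ContDiffAt ℝ ∞ (fun z : E × E ↦ ContinuousLinearMap.apply ℝ (E →L[ℝ] ℝ) z.2) z :=
    ContDiff.comp_contDiffAt (g := ⇑(ContinuousLinearMap.apply ℝ (E →L[ℝ] ℝ)))
      z (ContinuousLinearMap.contDiff _) h2
  have happ' : ContDiffAt ℝ ∞ (fun z : E × E ↦ ContinuousLinearMap.apply ℝ ℝ z.2) z :=
    ContDiff.comp_contDiffAt (g := ⇑(ContinuousLinearMap.apply ℝ ℝ))
      z (ContinuousLinearMap.contDiff _) h2
  obtain ⟨Φ, hΦ⟩ := hinv _ hz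
  have hi : ContDiffAt ℝ ∞ (fun z : E × E ↦ (G z.1).inverse) z :=
    ContDiffAt.comp (g := ContinuousLinearMap.inverse) z
      (by rw [← hΦ]; exact contDiffAt_map_inverse Φ) hGc
  exact hi.clm_apply (((hsc.clm_apply h2).sub ((hdc.clm_apply h2).clm_apply h2)).add
    ((happ'.clm_comp (happ.clm_comp hdc)).const_smul (1 / 2 : ℝ)))

end Coordinates

/-! ### Uniqueness and exponential map for second order equations -/

section SecondOrder

variable {E : Type*} [NormedAddCommGroup E] [NormedSpace ℝ E]

/-- Two solutions of `x'' = a (x, x')` with the same initial data agree near the initial time. -/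
theorem secondOrder_unique {a : E × E → E} {x₁ x₂ u₁ u₂ : ℝ → E} {t₀ : ℝ}
    (ha : ContDiffAt ℝ 1 a (x₁ t₀, u₁ t₀))
    (hx₁ : ∀ᶠ t in 𝓝 t₀, HasDerivAt x₁ (u₁ t) t) (hx₂ : ∀ᶠ t in 𝓝 t₀, HasDerivAt x₂ (u₂ t) t)
    (hu₁ : ∀ᶠ t in 𝓝 t₀, HasDerivAt u₁ (a (x₁ t, u₁ t)) t)
    (hu₂ : ∀ᶠ t in 𝓝 t₀, HasDerivAt u₂ (a (x₂ t, u₂ t)) t)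
    (hx : x₁ t₀ = x₂ t₀) (hu : u₁ t₀ = u₂ t₀) : x₁ =ᶠ[𝓝 t₀] x₂ := by
  have hV : ContDiffAt ℝ 1 (fun z : E × E ↦ (z.2, a z)) (x₁ t₀, u₁ t₀) := contDiffAt_snd.prodMk ha
  obtain ⟨K, s, hs, hL⟩ := hV.exists_lipschitzOnWith
  have hc₁ : ContinuousAt (fun t ↦ (x₁ t, u₁ t)) t₀ :=
    hx₁.self_of_nhds.continuousAt.prodMk hu₁.self_of_nhds.continuousAt
  have hc₂ : ContinuousAt (fun t ↦ (x₂ t, u₂ t)) t₀ :=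
    hx₂.self_of_nhds.continuousAt.prodMk hu₂.self_of_nhds.continuousAt
  have key := ODE_solution_unique_of_eventually (v := fun _ z ↦ (z.2, a z)) (s := fun _ ↦ s)
    (K := K) (f := fun t ↦ (x₁ t, u₁ t)) (g := fun t ↦ (x₂ t, u₂ t)) (t₀ := t₀)
    (Filter.Eventually.of_forall fun _ ↦ hL)
    (by
      filter_upwards [hx₁, hu₁, hc₁ hs] with t h1 h2 h3
      exact ⟨h1.prodMk h2, h3⟩)
    (by
      filter_upwards [hx₂, hu₂, hc₂ (by simpa only [← hx, ← hu] using hs)] with t h1 h2 h3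
      exact ⟨h1.prodMk h2, h3⟩)
    (by simp [hx, hu])
  exact key.mono fun t ht ↦ congrArg Prod.fst ht

/-- The flow of a `C¹` vector field near a zero `z₀`: for small times it stays in a given
neighbourhood of `z₀`, and it is Lipschitz in the initial point. -/
theorem exists_flow_near_zero [CompleteSpace E] {V : E → E} {z₀ : E} (hV : ContDiffAt ℝ 1 V z₀)
    (h0 : V z₀ = 0) {U : Set E} (hU : U ∈ 𝓝 z₀) :
    ∃ r > (0 : ℝ), ∃ δ > (0 : ℝ), ∃ L : NNReal, ∃ α : E → ℝ → E,
      (∀ z ∈ Metric.closedBall z₀ r, α z 0 = z ∧ ∀ t ∈ Ioo (-δ) δ,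
        HasDerivAt (α z) (V (α z t)) t ∧ α z t ∈ U) ∧
      (∀ t ∈ Ioo (-δ) δ, LipschitzOnWith L (α · t) (Metric.closedBall z₀ r)) ∧
      ∀ t ∈ Ioo (-δ) δ, α z₀ t = z₀ := by
  obtain ⟨K, s, hs, hL⟩ := hV.exists_lipschitzOnWith
  obtain ⟨δ₀, hδ₀, a, r₀, L₀, K₀, hr₀, hpl⟩ := IsPicardLindelof.of_contDiffAt_one hV
  obtain ⟨α, hα, L, hαL⟩ :=
    (hpl 0).exists_forall_mem_closedBall_eq_hasDerivWithinAt_lipschitzOnWith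
  simp only [zero_sub, zero_add] at hα hαL
  have hr₀' : (0 : ℝ) < r₀ := hr₀
  have hz₀ : z₀ ∈ Metric.closedBall z₀ (r₀ : ℝ) := Metric.mem_closedBall_self hr₀'.le
  obtain ⟨ρ, hρ, hρU⟩ := Metric.mem_nhds_iff.1 (Filter.inter_mem hU hs)
  have hd : ∀ z ∈ Metric.closedBall z₀ (r₀ : ℝ), ∀ t ∈ Ioo (-δ₀) δ₀,
      HasDerivAt (α z) (V (α z t)) t := fun z hz t ht ↦
    ((hα z hz).2 t (Ioo_subset_Icc_self ht)).hasDerivAt (Icc_mem_nhds ht.1 ht.2)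
  have hc : ContinuousAt (α z₀) 0 := (hd z₀ hz₀ 0 ⟨by linarith, hδ₀⟩).continuousAt
  obtain ⟨δ₁, hδ₁, hδ₁ρ⟩ := Metric.continuousAt_iff.1 hc (ρ / 2) (by positivity)
  set δ := min δ₀ δ₁ with hδ
  have hδpos : 0 < δ := lt_min hδ₀ hδ₁
  -- A solution starting within `ρ / (4 * (L + 1))` of `z₀` stays within `ρ / 4` of the one starting
  -- at `z₀`, which itself stays within `ρ / 2` of `z₀`; the `+ 1` avoids dividing by zero.
  set r := min (r₀ : ℝ) (ρ / (4 * (L + 1))) with hr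
  have hrpos : 0 < r := lt_min hr₀' (by positivity)
  have hsub : Ioo (-δ) δ ⊆ Ioo (-δ₀) δ₀ := Ioo_subset_Ioo (by simp [hδ]) (min_le_left _ _)
  have hrsub : Metric.closedBall z₀ r ⊆ Metric.closedBall z₀ r₀ :=
    Metric.closedBall_subset_closedBall (min_le_left _ _)
  have hmem : ∀ z ∈ Metric.closedBall z₀ r, ∀ t ∈ Ioo (-δ) δ, α z t ∈ Metric.ball z₀ ρ := by
    intro z hz t ht
    have h1 : dist (α z t) (α z₀ t) ≤ L * dist z z₀ :=
      (hαL t (Ioo_subset_Icc_self (hsub ht))).dist_le_mul z (hrsub hz) z₀ hz₀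
    have h2 : dist (α z₀ t) z₀ < ρ / 2 := by
      have := @hδ₁ρ t (by
        rw [Real.dist_eq, sub_zero, abs_lt]
        exact ⟨by linarith [ht.1, min_le_right δ₀ δ₁], by linarith [ht.2, min_le_right δ₀ δ₁]⟩)
      rwa [(hα z₀ hz₀).1] at this
    have h3 : dist z z₀ ≤ ρ / (4 * (L + 1)) := (Metric.mem_closedBall.1 hz).trans (min_le_right _ _)
    have h4 : (L : ℝ) * dist z z₀ ≤ ρ / 4 := by
      calc (L : ℝ) * dist z z₀ ≤ (L + 1) * (ρ / (4 * (L + 1))) := by gcongr; linarith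
        _ = ρ / 4 := by field_simp
    rw [Metric.mem_ball]
    calc dist (α z t) z₀ ≤ dist (α z t) (α z₀ t) + dist (α z₀ t) z₀ := dist_triangle _ _ _
      _ < ρ := by linarith
  refine ⟨r, hrpos, δ, hδpos, L, α, fun z hz ↦ ⟨(hα z (hrsub hz)).1, fun t ht ↦
    ⟨hd z (hrsub hz) t (hsub ht), (hρU (hmem z hz t ht)).1⟩⟩,
    fun t ht ↦ (hαL t (Ioo_subset_Icc_self (hsub ht))).mono hrsub, fun t ht ↦ ?_⟩
  -- As `z₀` is a zero of `V`, the constant curve is also a solution, so uniqueness identifies it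
  -- with `α z₀`.
  have hz₀' : z₀ ∈ Metric.closedBall z₀ r := Metric.mem_closedBall_self hrpos.le
  refine ODE_solution_unique_of_mem_Ioo (v := fun _ z ↦ V z) (s := fun _ ↦ s) (K := K)
    (f := α z₀) (g := fun _ ↦ z₀) (a := -δ) (b := δ) (t₀ := 0) (fun _ _ ↦ hL) ⟨by linarith, hδpos⟩
    (fun t ht ↦ ⟨hd z₀ hz₀ t (hsub ht), (hρU (hmem z₀ hz₀' t ht)).2⟩)
    (fun t ht ↦ ⟨by simpa [h0] using hasDerivAt_const t z₀, mem_of_mem_nhds hs⟩)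
    (hα z₀ hz₀).1 ht

/-- The exponential map of the second order equation `x'' = a (x, x')` at an equilibrium `p`:
solutions starting at `p` with small velocity `v` exist for a uniform time, and at a small time
`T` their position is close to `p + T v` up to a map with small Lipschitz constant. -/
theorem exists_secondOrder_exp [CompleteSpace E] {a : E × E → E} {p : E}
    (ha : ContDiffAt ℝ 1 a (p, 0)) (h0 : a (p, 0) = 0) {U : Set E} (hU : U ∈ 𝓝 p)
    {c : NNReal} (hc : 0 < c) :
    ∃ δ > (0 : ℝ), ∃ T : NNReal, 0 < T ∧ (T : ℝ) < δ ∧ ∃ r > (0 : ℝ), ∃ X X' : E → ℝ → E,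
      (∀ v ∈ Metric.closedBall (0 : E) r, X v 0 = p ∧ X' v 0 = v ∧ ∀ t ∈ Ioo (-δ) δ,
        X v t ∈ U ∧ HasDerivAt (X v) (X' v t) t ∧ HasDerivAt (X' v) (a (X v t, X' v t)) t) ∧
      (∀ v ∈ Metric.closedBall (0 : E) r, ∀ w ∈ Metric.closedBall (0 : E) r,
        ‖X v T - X w T - (T : ℝ) • (v - w)‖ ≤ c * T * ‖v - w‖) ∧
      X 0 T = p := by
  have hV : ContDiffAt ℝ 1 (fun z : E × E ↦ (z.2, a z)) (p, 0) := contDiffAt_snd.prodMk ha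
  obtain ⟨K, s, hs, hL⟩ := ha.exists_lipschitzOnWith
  obtain ⟨r, hr, δ, hδ, L, α, hα, hαL, hα0⟩ := exists_flow_near_zero hV (by simp [h0])
    (U := (U ×ˢ univ) ∩ s) (Filter.inter_mem (prod_mem_nhds hU Filter.univ_mem) hs)
  have hin : ∀ v ∈ Metric.closedBall (0 : E) r, (p, v) ∈ Metric.closedBall (p, (0 : E)) r := by
    intro v hv
    simpa [Prod.dist_eq, hr.le] using hv
  have hX : ∀ v ∈ Metric.closedBall (0 : E) r, ∀ t ∈ Ioo (-δ) δ,
      HasDerivAt (fun t ↦ (α (p, v) t).1) (α (p, v) t).2 t := fun v hv t ht ↦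
    (hasFDerivAt_fst (𝕜 := ℝ) (p := α (p, v) t)).comp_hasDerivAt t ((hα _ (hin v hv)).2 t ht).1
  have hX' : ∀ v ∈ Metric.closedBall (0 : E) r, ∀ t ∈ Ioo (-δ) δ,
      HasDerivAt (fun t ↦ (α (p, v) t).2) (a (α (p, v) t)) t := fun v hv t ht ↦
    (hasFDerivAt_snd (𝕜 := ℝ) (p := α (p, v) t)).comp_hasDerivAt t ((hα _ (hin v hv)).2 t ht).1
  -- The accelerations of two solutions differ by at most `K * L * ‖v - w‖`, so the bound `K * L * T
  -- ≤ c` limits the drift of the velocity difference up to time `T` to `c * ‖v - w‖`. The term `δ /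
  -- 2` keeps `T` inside the existence interval.
  set T : NNReal := min (Real.toNNReal (δ / 2)) (c / (K * L + 1)) with hT
  have hTpos : 0 < T := lt_min (by simpa using hδ) (by positivity)
  have hTδ : (T : ℝ) < δ := by
    have : (T : ℝ) ≤ δ / 2 := by
      have h : T ≤ Real.toNNReal (δ / 2) := min_le_left _ _
      rwa [← NNReal.coe_le_coe, Real.coe_toNNReal _ (by positivity)] at h
    linarith
  have hTc : (K : ℝ) * L * T ≤ c := by
    have h : T ≤ c / (K * L + 1) := min_le_right _ _
    have h' : (T : ℝ) ≤ c / (K * L + 1) := by exact_mod_cast h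
    calc (K : ℝ) * L * T ≤ (K * L + 1) * (c / (K * L + 1)) := by gcongr; linarith
      _ = c := by field_simp
  refine ⟨δ, hδ, T, hTpos, hTδ, r, hr, fun v t ↦ (α (p, v) t).1, fun v t ↦ (α (p, v) t).2,
    fun v hv ↦ ⟨by simp [(hα _ (hin v hv)).1], by simp [(hα _ (hin v hv)).1], fun t ht ↦
      ⟨((hα _ (hin v hv)).2 t ht).2.1.1, hX v hv t ht, hX' v hv t ht⟩⟩, fun v hv w hw ↦ ?_,
    by simp [hα0 T ⟨by linarith [T.2, NNReal.coe_nonneg T], hTδ⟩]⟩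
  have hsub : Icc (0 : ℝ) T ⊆ Ioo (-δ) δ := fun t ht ↦ ⟨by linarith [ht.1], by linarith [ht.2]⟩
  have hvel : ∀ t ∈ Icc (0 : ℝ) T, ‖(α (p, v) t).2 - (α (p, w) t).2 - (v - w)‖ ≤ c * ‖v - w‖ := by
    intro t ht
    have h := (convex_Icc (0 : ℝ) T).norm_image_sub_le_of_norm_hasDerivWithin_le
      (f := fun t ↦ (α (p, v) t).2 - (α (p, w) t).2)
      (f' := fun t ↦ a (α (p, v) t) - a (α (p, w) t)) (C := K * L * ‖v - w‖) (x := 0) (y := t)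
      (fun t ht ↦ ((hX' v hv t (hsub ht)).sub (hX' w hw t (hsub ht))).hasDerivWithinAt)
      (fun t ht ↦ by
        have h1 := hL.dist_le_mul _ ((hα _ (hin v hv)).2 t (hsub ht)).2.2
          _ ((hα _ (hin w hw)).2 t (hsub ht)).2.2
        have h2 := (hαL t (hsub ht)).dist_le_mul _ (hin v hv) _ (hin w hw)
        rw [dist_eq_norm] at h1
        have h3 : dist (p, v) (p, w) = ‖v - w‖ := by
          simp [dist_eq_norm]
        rw [h3] at h2
        calc _ ≤ _ := h1
          _ ≤ K * (L * ‖v - w‖) := by gcongr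
          _ = _ := by ring)
      ⟨le_rfl, T.2⟩ ht
    simp only [(hα _ (hin v hv)).1, (hα _ (hin w hw)).1, sub_zero, Real.norm_eq_abs,
      abs_of_nonneg ht.1] at h
    calc _ ≤ _ := h
      _ ≤ K * L * ‖v - w‖ * T := by gcongr; exact ht.2
      _ = (K * L * T) * ‖v - w‖ := by ring
      _ ≤ _ := by gcongr
  -- A second use of the mean value inequality turns the velocity estimate into the position
  -- estimate, at the price of a factor `T`.
  have h := (convex_Icc (0 : ℝ) T).norm_image_sub_le_of_norm_hasDerivWithin_le
      (f := fun t ↦ (α (p, v) t).1 - (α (p, w) t).1 - t • (v - w))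
      (f' := fun t ↦ (α (p, v) t).2 - (α (p, w) t).2 - (v - w)) (C := c * ‖v - w‖)
      (x := 0) (y := T)
      (fun t ht ↦ (((hX v hv t (hsub ht)).sub (hX w hw t (hsub ht))).sub
        (by simpa using (hasDerivAt_id t).smul_const (v - w))).hasDerivWithinAt)
      hvel ⟨le_rfl, T.2⟩ ⟨T.2, le_rfl⟩
  simp only [(hα _ (hin v hv)).1, (hα _ (hin w hw)).1, sub_zero, Real.norm_eq_abs, sub_self,
    zero_smul, NNReal.abs_eq] at h
  calc _ ≤ _ := h
    _ = _ := by ring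

end SecondOrder

/-! ### Bilinear forms in charts -/

section ChartForms

variable {n : ℕ} {M : Type*} [TopologicalSpace M] [ChartedSpace (Model n) M]

/-- A field of bilinear forms on `M` in the coordinates of the chart `e`. -/
def chartForm (B : ∀ x : M, TangentSpace (𝓡 n) x →L[ℝ] TangentSpace (𝓡 n) x →L[ℝ] ℝ)
    (e : OpenPartialHomeomorph M (Model n)) (y : Model n) : Model n →L[ℝ] Model n →L[ℝ] ℝ :=
  ContinuousLinearMap.bilinearComp (E := Model n) (F := Model n) (E' := Model n) (F' := Model n)
    (B (e.symm y)) (mfderiv (𝓡 n) (𝓡 n) e.symm y) (mfderiv (𝓡 n) (𝓡 n) e.symm y)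

theorem chartForm_apply (B : ∀ x : M, TangentSpace (𝓡 n) x →L[ℝ] TangentSpace (𝓡 n) x →L[ℝ] ℝ)
    (e : OpenPartialHomeomorph M (Model n)) (y u v : Model n) :
    chartForm B e y u v = B (e.symm y) (mfderiv (𝓡 n) (𝓡 n) e.symm y u)
      (mfderiv (𝓡 n) (𝓡 n) e.symm y v) := rfl

variable [IsManifold (𝓡 n) ∞ M]

/-- In finite dimension it is enough to evaluate on constant vectors. The differential of `e.symm`
makes each of them a smooth field along `e.symm`, and pairing smooth fields with a smooth form is
smooth. -/
theorem contDiffOn_chartForm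
    {B : ∀ x : M, TangentSpace (𝓡 n) x →L[ℝ] TangentSpace (𝓡 n) x →L[ℝ] ℝ}
    (hB : ContMDiff (𝓡 n) ((𝓡 n).prod 𝓘(ℝ, Model n →L[ℝ] Model n →L[ℝ] ℝ)) ∞
      (fun x ↦ TotalSpace.mk' (Model n →L[ℝ] Model n →L[ℝ] ℝ) x (B x)))
    {e : OpenPartialHomeomorph M (Model n)} (he : e ∈ IsManifold.maximalAtlas (𝓡 n) ∞ M) :
    ContDiffOn ℝ ∞ (chartForm B e) e.target := by
  rw [contDiffOn_clm_apply]
  intro u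
  rw [contDiffOn_clm_apply]
  intro v
  have hsymm := contMDiffOn_symm_of_mem_maximalAtlas he
  have hv : ∀ u : Model n, ContMDiffOn (𝓡 n) ((𝓡 n).prod 𝓘(ℝ, Model n)) ∞
      (fun y ↦ TotalSpace.mk' (Model n) (E := (TangentSpace (𝓡 n) : M → Type _)) (e.symm y)
        (mfderiv (𝓡 n) (𝓡 n) e.symm y u)) e.target := by
    intro u
    have h1 : ContMDiffOn (𝓡 n) (𝓡 n).tangent ∞
        (fun y ↦ (⟨y, u⟩ : TangentBundle (𝓡 n) (Model n))) e.target :=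
      contMDiffOn_vectorSpace_iff_contDiffOn.2 contDiffOn_const
    have h2 := (hsymm.contMDiffOn_tangentMapWithin (m := ∞) (by simp)
      e.open_target.uniqueMDiffOn).comp h1 (fun y hy ↦ hy)
    refine h2.congr fun y hy ↦ ?_
    simp only [Function.comp, tangentMapWithin, mfderivWithin_of_isOpen e.open_target hy]
  have h := ContMDiffOn.clm_bundle_apply₂ (F₁ := Model n) (F₂ := Model n) (F₃ := ℝ)
    (E₁ := (TangentSpace (𝓡 n) : M → Type _)) (E₂ := (TangentSpace (𝓡 n) : M → Type _))
    (E₃ := fun _ : M ↦ ℝ) (b := e.symm) (ψ := fun y ↦ B (e.symm y))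
    (hB.comp_contMDiffOn hsymm) (hv u) (hv v)
  rw [← contMDiffOn_iff_contDiffOn]
  intro y hy
  have h' := h y hy
  simp only [contMDiffWithinAt_totalSpace] at h'
  exact h'.2

end ChartForms

/-! ### Invariance under magnetomorphisms and changes of chart -/

section Transitions

variable {n : ℕ} {M : Type*} [TopologicalSpace M] [ChartedSpace (Model n) M]

theorem mdifferentiable_of_mem_maximalAtlas {e : OpenPartialHomeomorph M (Model n)}
    (he : e ∈ IsManifold.maximalAtlas (𝓡 n) ∞ M) : e.MDifferentiable (𝓡 n) (𝓡 n) :=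
  ⟨(contMDiffOn_of_mem_maximalAtlas he).mdifferentiableOn (by simp),
    (contMDiffOn_symm_of_mem_maximalAtlas he).mdifferentiableOn (by simp)⟩

/-- A diffeomorphism in the charts `e` and `e'`. -/
def localRep (e e' : OpenPartialHomeomorph M (Model n)) (F : M ≃ₘ⟮𝓡 n, 𝓡 n⟯ M)
    (y : Model n) : Model n := e' (F (e.symm y))

variable {e e' : OpenPartialHomeomorph M (Model n)} {F : M ≃ₘ⟮𝓡 n, 𝓡 n⟯ M}

theorem contDiffAt_localRep (he : e ∈ IsManifold.maximalAtlas (𝓡 n) ∞ M)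
    (he' : e' ∈ IsManifold.maximalAtlas (𝓡 n) ∞ M) {y : Model n} (hy : y ∈ e.target)
    (hFy : F (e.symm y) ∈ e'.source) : ContDiffAt ℝ ∞ (localRep e e' F) y := by
  rw [← contMDiffAt_iff_contDiffAt]
  have h1 : ContMDiffAt (𝓡 n) (𝓡 n) ∞ e.symm y :=
    (contMDiffOn_symm_of_mem_maximalAtlas he).contMDiffAt (e.open_target.mem_nhds hy)
  have h2 : ContMDiffAt (𝓡 n) (𝓡 n) ∞ F (e.symm y) := F.contMDiff.contMDiffAt
  have h3 : ContMDiffAt (𝓡 n) (𝓡 n) ∞ e' (F (e.symm y)) :=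
    (contMDiffOn_of_mem_maximalAtlas he').contMDiffAt (e'.open_source.mem_nhds hFy)
  exact h3.comp y (h2.comp y h1)

theorem eventually_localRep (e' : OpenPartialHomeomorph M (Model n)) {y : Model n}
    (hy : y ∈ e.target) (hFy : F (e.symm y) ∈ e'.source) :
    ∀ᶠ z in 𝓝 y, z ∈ e.target ∧ F (e.symm z) ∈ e'.source := by
  refine (e.open_target.eventually_mem hy).and ?_
  have hc : ContinuousAt (fun z ↦ F (e.symm z)) y :=
    F.continuous.continuousAt.comp (e.continuousAt_symm hy)
  exact hc.eventually_mem (e'.open_source.mem_nhds hFy)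

/-- The chain rule applied to `e'.symm ∘ localRep e e' F = F ∘ e.symm`, which holds near `y`. -/
theorem mfderiv_symm_fderiv_localRep (he : e ∈ IsManifold.maximalAtlas (𝓡 n) ∞ M)
    (he' : e' ∈ IsManifold.maximalAtlas (𝓡 n) ∞ M) {y : Model n} (hy : y ∈ e.target)
    (hFy : F (e.symm y) ∈ e'.source) (u : Model n) :
    (mfderiv (𝓡 n) (𝓡 n) e'.symm (localRep e e' F y) (fderiv ℝ (localRep e e' F) y u) : Model n) =
      mfderiv (𝓡 n) (𝓡 n) F (e.symm y) (mfderiv (𝓡 n) (𝓡 n) e.symm y u) := by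
  have h1 : MDifferentiableAt (𝓡 n) (𝓡 n) e.symm y :=
    (mdifferentiable_of_mem_maximalAtlas he).mdifferentiableAt_symm hy
  have h2 : MDifferentiableAt (𝓡 n) (𝓡 n) F (e.symm y) :=
    F.contMDiff.contMDiffAt.mdifferentiableAt (by simp)
  have h3 : MDifferentiableAt (𝓡 n) (𝓡 n) e'.symm (localRep e e' F y) :=
    (mdifferentiable_of_mem_maximalAtlas he').mdifferentiableAt_symm (e'.map_source hFy)
  have h4 : MDifferentiableAt (𝓡 n) (𝓡 n) (localRep e e' F) y :=
    ((contDiffAt_localRep he he' hy hFy).differentiableAt (by simp)).mdifferentiableAt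
  have hEq : e'.symm ∘ localRep e e' F =ᶠ[𝓝 y] F ∘ e.symm := by
    filter_upwards [eventually_localRep e' hy hFy] with z hz
    exact e'.left_inv hz.2
  have h5 := hEq.mfderiv_eq (I := 𝓡 n) (I' := 𝓡 n)
  rw [mfderiv_comp y h3 h4, mfderiv_comp y h2 h1, mfderiv_eq_fderiv] at h5
  exact congrArg (fun L : Model n →L[ℝ] Model n ↦ L u) h5

theorem _root_.ContMDiffAt.contDiffAt_chart {γ : ℝ → M} {t : ℝ}
    (hγ : ContMDiffAt 𝓘(ℝ, ℝ) (𝓡 n) 2 γ t)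
    (he : e ∈ IsManifold.maximalAtlas (𝓡 n) ∞ M) (ht : γ t ∈ e.source) :
    ContDiffAt ℝ 2 (fun s ↦ e (γ s)) t := by
  rw [← contMDiffAt_iff_contDiffAt]
  have h : ContMDiffAt (𝓡 n) (𝓡 n) 2 e (γ t) :=
    ((contMDiffOn_of_mem_maximalAtlas he).contMDiffAt (e.open_source.mem_nhds ht)).of_le
      (by exact ENat.LEInfty.out)
  exact h.comp t hγ

theorem deriv_deriv_comp {E : Type*} [NormedAddCommGroup E] [NormedSpace ℝ E] {ψ : E → E}
    {x : ℝ → E} {t : ℝ} (hψ : ContDiffAt ℝ 2 ψ (x t)) (hx : ContDiffAt ℝ 2 x t) :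
    deriv (fun s ↦ ψ (x s)) t = fderiv ℝ ψ (x t) (deriv x t) ∧
    deriv (deriv fun s ↦ ψ (x s)) t = fderiv ℝ ψ (x t) (deriv (deriv x) t) +
      fderiv ℝ (fderiv ℝ ψ) (x t) (deriv x t) (deriv x t) := by
  have h1 : ∀ᶠ s in 𝓝 t, deriv (fun s ↦ ψ (x s)) s = fderiv ℝ ψ (x s) (deriv x s) := by
    have hx' := hx.eventually (by simp)
    have hψ' := hx.continuousAt.eventually (hψ.eventually (by simp))
    filter_upwards [hx', hψ'] with s hs hs'
    exact ((hs'.differentiableAt (by simp)).hasFDerivAt.comp_hasDerivAt s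
      (hs.differentiableAt (by simp)).hasDerivAt).deriv
  refine ⟨h1.self_of_nhds, ?_⟩
  rw [Filter.EventuallyEq.deriv_eq h1]
  have hψ2 : DifferentiableAt ℝ (fderiv ℝ ψ) (x t) :=
    (hψ.fderiv_right (m := 1) (by norm_num)).differentiableAt (by norm_num)
  have hx2 : DifferentiableAt ℝ (deriv x) t := by
    have := (hx.fderiv_right (m := 1) (by norm_num)).differentiableAt (by norm_num)
    exact this.clm_apply (differentiableAt_const (1 : ℝ))
  have hc := (hψ2.hasFDerivAt.comp_hasDerivAt t (hx.differentiableAt (by simp)).hasDerivAt)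
  exact (hc.clm_apply hx2.hasDerivAt).deriv.trans (add_comm _ _)

theorem chartForm_localRep
    {B : ∀ x : M, TangentSpace (𝓡 n) x →L[ℝ] TangentSpace (𝓡 n) x →L[ℝ] ℝ}
    (hB : ∀ (x : M) (u v : TangentSpace (𝓡 n) x),
      B (F x) (mfderiv (𝓡 n) (𝓡 n) F x u) (mfderiv (𝓡 n) (𝓡 n) F x v) = B x u v)
    (he : e ∈ IsManifold.maximalAtlas (𝓡 n) ∞ M)
    (he' : e' ∈ IsManifold.maximalAtlas (𝓡 n) ∞ M) {y : Model n} (hy : y ∈ e.target)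
    (hFy : F (e.symm y) ∈ e'.source) (u v : Model n) :
    chartForm B e' (localRep e e' F y) (fderiv ℝ (localRep e e' F) y u)
      (fderiv ℝ (localRep e e' F) y v) = chartForm B e y u v := by
  -- The base points agree only through `left_inv`. Every tangent space is the model space by
  -- definition, so forms at equal points can be compared without transport.
  have hcongr : ∀ (q q' : M), q = q' → ∀ a b : Model n,
      (B q : Model n →L[ℝ] Model n →L[ℝ] ℝ) a b = (B q' : Model n →L[ℝ] Model n →L[ℝ] ℝ) a b := by
    rintro q _ rfl a b; rfl
  rw [chartForm_apply, chartForm_apply, ← hB (e.symm y)]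
  refine (hcongr _ (F (e.symm y)) (e'.left_inv hFy) _ _).trans ?_
  rw [mfderiv_symm_fderiv_localRep he he' hy hFy, mfderiv_symm_fderiv_localRep he he' hy hFy]

variable [IsManifold (𝓡 n) ∞ M]

theorem chartForm_metric_pos (g : Metric n M) {e : OpenPartialHomeomorph M (Model n)}
    (he : e ∈ IsManifold.maximalAtlas (𝓡 n) ∞ M) {y : Model n} (hy : y ∈ e.target)
    {v : Model n} (hv : v ≠ 0) : 0 < chartForm g.inner e y v v := by
  refine g.pos (e.symm y) _ fun h ↦ hv ?_
  have hinj := (mdifferentiable_of_mem_maximalAtlas he).symm.mfderiv_injective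
    (x := y) (by simpa using hy)
  exact hinj (h.trans (map_zero _).symm)

theorem chartForm_metric_symm (g : Metric n M) (e : OpenPartialHomeomorph M (Model n))
    (y u v : Model n) : chartForm g.inner e y u v = chartForm g.inner e y v u :=
  g.symm _ _ _

theorem isInvertible_chartForm_metric (g : Metric n M) {e : OpenPartialHomeomorph M (Model n)}
    (he : e ∈ IsManifold.maximalAtlas (𝓡 n) ∞ M) {y : Model n} (hy : y ∈ e.target) :
    (chartForm g.inner e y).IsInvertible :=
  isInvertible_of_posDef fun _ hv ↦ chartForm_metric_pos g he hy hv

namespace MagneticSystem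

variable (S : MagneticSystem n M)

/-- The equation of magnetic geodesics at time `t`, in the chart `e`. -/
def MagneticEqAt (e : OpenPartialHomeomorph M (Model n)) (γ : ℝ → M) (t : ℝ) : Prop :=
  ∀ w, magneticResidual (chartForm S.metric.inner e) (chartForm S.form e) (e (γ t))
    (deriv (fun s ↦ e (γ s)) t) (deriv (deriv fun s ↦ e (γ s)) t) w = 0

/-- A `C²` solution of the equation of magnetic geodesics. -/
structure IsMagneticCurveOn (γ : ℝ → M) (J : Set ℝ) : Prop where
  contMDiffAt : ∀ t ∈ J, ContMDiffAt 𝓘(ℝ, ℝ) (𝓡 n) 2 γ t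
  magneticEqAt : ∀ t ∈ J, ∀ e ∈ IsManifold.maximalAtlas (𝓡 n) ∞ M, γ t ∈ e.source →
    S.MagneticEqAt e γ t

variable {S}

theorem MagneticEqAt.map {γ : ℝ → M} {t : ℝ} (h : S.MagneticEqAt e γ t) (hF : F ∈ S.Mag)
    (hγ : ContMDiffAt 𝓘(ℝ, ℝ) (𝓡 n) 2 γ t)
    (he : e ∈ IsManifold.maximalAtlas (𝓡 n) ∞ M)
    (he' : e' ∈ IsManifold.maximalAtlas (𝓡 n) ∞ M)
    (ht : γ t ∈ e.source) (hFt : F (γ t) ∈ e'.source) :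
    S.MagneticEqAt e' (fun s ↦ F (γ s)) t := by
  have hx := hγ.contDiffAt_chart he ht
  have hy : e (γ t) ∈ e.target := e.map_source ht
  have hFy : F (e.symm (e (γ t))) ∈ e'.source := by rwa [e.left_inv ht]
  have hψ : ContDiffAt ℝ 2 (localRep e e' F) (e (γ t)) :=
    (contDiffAt_localRep he he' hy hFy).of_le (by exact ENat.LEInfty.out)
  have hEq : (fun s ↦ e' (F (γ s))) =ᶠ[𝓝 t] fun s ↦ localRep e e' F (e (γ s)) := by
    filter_upwards [hγ.continuousAt.eventually_mem (e.open_source.mem_nhds ht)] with s hs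
    simp only [localRep, e.left_inv hs]
  have hG := contDiffOn_chartForm S.metric.contMDiff he
  have hG' := contDiffOn_chartForm S.metric.contMDiff he'
  have hd := deriv_deriv_comp hψ hx
  -- An isometry is injective, hence surjective in equal dimensions, so every test vector `w` is the
  -- image of one for the original curve.
  have hsurj : Function.Surjective (fderiv ℝ (localRep e e' F) (e (γ t))) := by
    refine LinearMap.surjective_of_injective (K := ℝ)
      (f := (fderiv ℝ (localRep e e' F) (e (γ t))).toLinearMap) ?_
    rw [← LinearMap.ker_eq_bot, LinearMap.ker_eq_bot']
    intro v hv
    by_contra hne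
    have h1 := chartForm_localRep (fun x u v ↦ (hF x u v).1) he he' hy hFy v v
    rw [show fderiv ℝ (localRep e e' F) (e (γ t)) v = 0 from hv] at h1
    exact (chartForm_metric_pos S.metric he hy hne).ne' (by simpa using h1.symm)
  intro w
  obtain ⟨w, rfl⟩ := hsurj w
  show magneticResidual _ _ (e' (F (γ t))) (deriv (fun s ↦ e' (F (γ s))) t)
    (deriv (deriv fun s ↦ e' (F (γ s))) t) _ = 0
  rw [hEq.deriv_eq, hEq.deriv.deriv_eq, hd.1, hd.2, show e' (F (γ t)) =
    localRep e e' F (e (γ t)) from hEq.self_of_nhds]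
  rw [magneticResidual_map hψ
    ((hG'.contDiffAt (e'.open_target.mem_nhds (e'.map_source hFy))).differentiableAt (by simp))
    (chartForm_metric_symm _ _ _)
    ((eventually_localRep e' hy hFy).mono fun z hz u v ↦
      chartForm_localRep (fun x u v ↦ (hF x u v).1) he he' hz.1 hz.2 u v)
    ((hG.contDiffAt (e.open_target.mem_nhds hy)).differentiableAt (by simp))
    (chartForm_localRep (fun x u v ↦ (hF x u v).2) he he' hy hFy)]
  exact h w

/-- Lets `MagneticEqAt.map`, applied to the identity, serve as the change of chart formula. -/
theorem refl_mem_Mag : Diffeomorph.refl (𝓡 n) M ∞ ∈ S.Mag := by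
  intro x u v
  simp only [Diffeomorph.coe_refl, mfderiv_id]
  exact ⟨rfl, rfl⟩

theorem IsMagneticCurveOn.map {γ : ℝ → M} {J : Set ℝ} (h : S.IsMagneticCurveOn γ J)
    (hF : F ∈ S.Mag) : S.IsMagneticCurveOn (fun t ↦ F (γ t)) J where
  contMDiffAt t ht := (F.contMDiff.contMDiffAt.of_le (by exact ENat.LEInfty.out)).comp t
    (h.contMDiffAt t ht)
  magneticEqAt t ht e he hte :=
    (h.magneticEqAt t ht _ (IsManifold.chart_mem_maximalAtlas (γ t)) (mem_chart_source _ _)).map hF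
      (h.contMDiffAt t ht) (IsManifold.chart_mem_maximalAtlas _) he (mem_chart_source _ _) hte

/-- A change of chart is the local representative of the identity, so the equation in one chart
implies it in all of them. -/
theorem isMagneticCurveOn_of_chart {γ : ℝ → M} {J : Set ℝ}
    (he : e ∈ IsManifold.maximalAtlas (𝓡 n) ∞ M) (hγ : ∀ t ∈ J, γ t ∈ e.source)
    (hd : ∀ t ∈ J, ContMDiffAt 𝓘(ℝ, ℝ) (𝓡 n) 2 γ t) (h : ∀ t ∈ J, S.MagneticEqAt e γ t) :
    S.IsMagneticCurveOn γ J :=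
  ⟨hd, fun t ht _ he' hte' ↦ (h t ht).map (F := Diffeomorph.refl (𝓡 n) M ∞) refl_mem_Mag (hd t ht)
    he he' (hγ t ht) hte'⟩

end MagneticSystem

end Transitions

/-! ### Uniqueness of magnetic curves -/

section MagneticCurves

variable {n : ℕ} {M : Type*} [TopologicalSpace M] [ChartedSpace (Model n) M]
  [IsManifold (𝓡 n) ∞ M]

namespace MagneticSystem

variable {S : MagneticSystem n M} {e : OpenPartialHomeomorph M (Model n)}

/-- The acceleration of magnetic geodesics in the chart `e`. -/
def chartAccel (S : MagneticSystem n M) (e : OpenPartialHomeomorph M (Model n)) :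
    Model n × Model n → Model n :=
  magneticAccel (chartForm S.metric.inner e) (chartForm S.form e)

theorem contDiffAt_chartAccel (he : e ∈ IsManifold.maximalAtlas (𝓡 n) ∞ M)
    {z : Model n × Model n} (hz : z.1 ∈ e.target) : ContDiffAt ℝ ∞ (S.chartAccel e) z :=
  contDiffAt_magneticAccel e.open_target (contDiffOn_chartForm S.metric.contMDiff he)
    (contDiffOn_chartForm S.form_smooth he)
    (fun _ hx ↦ isInvertible_chartForm_metric S.metric he hx) hz

theorem magneticEqAt_iff (he : e ∈ IsManifold.maximalAtlas (𝓡 n) ∞ M) {γ : ℝ → M} {t : ℝ}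
    (ht : γ t ∈ e.source) : S.MagneticEqAt e γ t ↔
      deriv (deriv fun s ↦ e (γ s)) t = S.chartAccel e (e (γ t), deriv (fun s ↦ e (γ s)) t) :=
  magneticResidual_eq_zero_iff
    (isInvertible_chartForm_metric S.metric he (e.map_source ht)) _ _

theorem IsMagneticCurveOn.eventuallyEq {γ₁ γ₂ : ℝ → M} {J : Set ℝ} (hJ : IsOpen J)
    (h₁ : S.IsMagneticCurveOn γ₁ J) (h₂ : S.IsMagneticCurveOn γ₂ J) {t : ℝ} (ht : t ∈ J)
    (h : γ₁ t = γ₂ t) (he : e ∈ IsManifold.maximalAtlas (𝓡 n) ∞ M) (hte : γ₁ t ∈ e.source)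
    (hd : deriv (fun s ↦ e (γ₁ s)) t = deriv (fun s ↦ e (γ₂ s)) t) : γ₁ =ᶠ[𝓝 t] γ₂ := by
  have key : ∀ γ : ℝ → M, S.IsMagneticCurveOn γ J → γ t ∈ e.source →
      (∀ᶠ s in 𝓝 t, γ s ∈ e.source) ∧
      (∀ᶠ s in 𝓝 t, HasDerivAt (fun s ↦ e (γ s)) (deriv (fun s ↦ e (γ s)) s) s) ∧
      ∀ᶠ s in 𝓝 t, HasDerivAt (deriv fun s ↦ e (γ s))
        (S.chartAccel e (e (γ s), deriv (fun s ↦ e (γ s)) s)) s := by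
    intro γ hγ hγt
    have hs : ∀ᶠ s in 𝓝 t, γ s ∈ e.source ∧ s ∈ J :=
      ((hγ.contMDiffAt t ht).continuousAt.eventually_mem (e.open_source.mem_nhds hγt)).and
        (hJ.mem_nhds ht)
    refine ⟨hs.mono fun s hs ↦ hs.1, hs.mono fun s hs ↦ ?_, hs.mono fun s hs ↦ ?_⟩
    · exact (((hγ.contMDiffAt s hs.2).contDiffAt_chart he hs.1).differentiableAt
        (by simp)).hasDerivAt
    · rw [← (magneticEqAt_iff he hs.1).1 (hγ.magneticEqAt s hs.2 e he hs.1)]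
      have := ((hγ.contMDiffAt s hs.2).contDiffAt_chart he hs.1)
      exact (((this.fderiv_right (m := 1) (by norm_num)).differentiableAt (by norm_num)).clm_apply
        (differentiableAt_const (1 : ℝ))).hasDerivAt
  obtain ⟨a₁, b₁, c₁⟩ := key γ₁ h₁ hte
  obtain ⟨a₂, b₂, c₂⟩ := key γ₂ h₂ (h ▸ hte)
  have := secondOrder_unique (a := S.chartAccel e)
    ((contDiffAt_chartAccel he (e.map_source hte)).of_le (by simp)) b₁ b₂ c₁ c₂ (by rw [h]) hd
  filter_upwards [this, a₁, a₂] with s hs h1 h2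
  exact e.injOn h1 h2 hs

/-- The set of times near which the curves coincide is open. It is closed in `J`: at a limit time
positions and chart velocities agree by continuity, and local uniqueness applies again. -/
theorem IsMagneticCurveOn.eqOn [T2Space M] {γ₁ γ₂ : ℝ → M} {J : Set ℝ} (hJ : IsOpen J)
    (hJ' : IsPreconnected J) (h₁ : S.IsMagneticCurveOn γ₁ J) (h₂ : S.IsMagneticCurveOn γ₂ J)
    {t₀ : ℝ} (ht₀ : t₀ ∈ J) (h : γ₁ t₀ = γ₂ t₀) (he : e ∈ IsManifold.maximalAtlas (𝓡 n) ∞ M)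
    (hte : γ₁ t₀ ∈ e.source)
    (hd : deriv (fun s ↦ e (γ₁ s)) t₀ = deriv (fun s ↦ e (γ₂ s)) t₀) : EqOn γ₁ γ₂ J := by
  suffices J ⊆ {t | γ₁ =ᶠ[𝓝 t] γ₂} from fun t ht ↦ (this ht).self_of_nhds
  refine hJ'.subset_of_closure_inter_subset isOpen_setOfPred_eventually_nhds
    ⟨t₀, ht₀, h₁.eventuallyEq hJ h₂ ht₀ h he hte hd⟩ ?_
  rintro t ⟨htA, htJ⟩
  have hfreq : ∃ᶠ s in 𝓝 t, γ₁ =ᶠ[𝓝 s] γ₂ := mem_closure_iff_frequently.1 htA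
  have c₁ := (h₁.contMDiffAt t htJ)
  have c₂ := (h₂.contMDiffAt t htJ)
  have heq : γ₁ t = γ₂ t := tendsto_nhds_unique_of_frequently_eq c₁.continuousAt c₂.continuousAt
    (hfreq.mono fun s hs ↦ hs.self_of_nhds)
  have he₀ := IsManifold.chart_mem_maximalAtlas (I := 𝓡 n) (n := ∞) (γ₁ t)
  have hcd : ∀ γ : ℝ → M, ContMDiffAt 𝓘(ℝ, ℝ) (𝓡 n) 2 γ t →
      γ t ∈ (chartAt (Model n) (γ₁ t)).source →
      ContinuousAt (deriv fun s ↦ chartAt (Model n) (γ₁ t) (γ s)) t := fun γ hγ ht ↦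
    (((hγ.contDiffAt_chart he₀ ht).fderiv_right (m := 1) (by norm_num)).continuousAt.clm_apply
      (continuousAt_const (y := (1 : ℝ))))
  refine h₁.eventuallyEq hJ h₂ htJ heq he₀ (mem_chart_source _ _)
    (tendsto_nhds_unique_of_frequently_eq (hcd γ₁ c₁ (mem_chart_source _ _))
      (hcd γ₂ c₂ (heq ▸ mem_chart_source _ _)) (hfreq.mono fun s hs ↦ ?_))
  exact Filter.EventuallyEq.deriv_eq (hs.mono fun r hr ↦ by simp only [hr])

end MagneticSystem

/-! ### From Christoffel symbols to the covector form of the equation -/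

section Christoffel

variable {S : MagneticSystem n M} {e : OpenPartialHomeomorph M (Model n)}

theorem gram_eq (g : Metric n M) (y : Model n) (i j : Fin n) :
    gram g e y i j = chartForm g.inner e y (EuclideanSpace.single i (1 : ℝ))
      (EuclideanSpace.single j (1 : ℝ)) := rfl

theorem model_eq_sum (u : Model n) : u = ∑ i, u i • EuclideanSpace.single i (1 : ℝ) := by
  ext j
  simp [Pi.single_apply]

theorem bilin_apply_eq_sum (B : Model n →L[ℝ] Model n →L[ℝ] ℝ) (u w : Model n) :
    B u w = ∑ i, u i * B (EuclideanSpace.single i (1 : ℝ)) w := by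
  conv_lhs => rw [model_eq_sum u]
  simp

theorem bilin_apply_eq_sum_right (B : Model n →L[ℝ] Model n →L[ℝ] ℝ) (u w : Model n) :
    B u w = ∑ i, w i * B u (EuclideanSpace.single i (1 : ℝ)) := by
  conv_lhs => rw [model_eq_sum w]
  simp

theorem gram_mulVec_eq (g : Metric n M) (y v : Model n) (i : Fin n) :
    (gram g e y).mulVec v i = chartForm g.inner e y v (EuclideanSpace.single i (1 : ℝ)) := by
  rw [bilin_apply_eq_sum]
  simp only [Matrix.mulVec, dotProduct, gram_eq]
  exact Finset.sum_congr rfl fun j _ ↦ by rw [chartForm_metric_symm, mul_comm]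

theorem isUnit_det_gram (g : Metric n M) (he : e ∈ IsManifold.maximalAtlas (𝓡 n) ∞ M)
    {y : Model n} (hy : y ∈ e.target) : IsUnit (gram g e y).det := by
  rw [isUnit_iff_ne_zero]
  intro h
  obtain ⟨v, hv, hv0⟩ := Matrix.exists_mulVec_eq_zero_iff.2 h
  have hne : (WithLp.toLp 2 v : Model n) ≠ 0 := fun h' ↦ hv (by
    ext i; exact congrArg (fun w : Model n ↦ w i) h')
  refine (chartForm_metric_pos g he hy hne).ne' ?_
  rw [bilin_apply_eq_sum]
  refine Finset.sum_eq_zero fun i _ ↦ ?_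
  rw [chartForm_metric_symm, ← gram_mulVec_eq]
  simp [hv0]

theorem dGram_eq (g : Metric n M) (he : e ∈ IsManifold.maximalAtlas (𝓡 n) ∞ M)
    {y : Model n} (hy : y ∈ e.target) (i j l : Fin n) :
    dGram g e i j l y = fderiv ℝ (chartForm g.inner e) y (EuclideanSpace.single i (1 : ℝ))
      (EuclideanSpace.single j (1 : ℝ)) (EuclideanSpace.single l (1 : ℝ)) := by
  have hd : DifferentiableAt ℝ (chartForm g.inner e) y :=
    ((contDiffOn_chartForm g.contMDiff he).contDiffAt (e.open_target.mem_nhds hy)).differentiableAt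
      (by simp)
  have h := (hd.hasFDerivAt.clm_apply
    (hasFDerivAt_const (EuclideanSpace.single j (1 : ℝ) : Model n) y)).clm_apply
    (hasFDerivAt_const (EuclideanSpace.single l (1 : ℝ) : Model n) y)
  unfold dGram
  rw [show (fun z ↦ gram g e z j l) = fun z ↦ chartForm g.inner e z
    (EuclideanSpace.single j (1 : ℝ)) (EuclideanSpace.single l (1 : ℝ)) from rfl, h.fderiv]
  simp

/-- Lowering the upper index of the Christoffel symbols gives the first derivatives of the
metric. -/
theorem chartForm_christoffel (g : Metric n M) (he : e ∈ IsManifold.maximalAtlas (𝓡 n) ∞ M)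
    {y : Model n} (hy : y ∈ e.target) (u w : Model n) :
    chartForm g.inner e y
      (WithLp.toLp 2 fun k ↦ ∑ i, ∑ j, christoffel g e k i j y * u i * u j) w =
      fderiv ℝ (chartForm g.inner e) y u u w - 1 / 2 * fderiv ℝ (chartForm g.inner e) y w u u := by
  set D := fderiv ℝ (chartForm g.inner e) y with hD
  -- Multiplying by the Gram matrix cancels its inverse in the definition of the Christoffel
  -- symbols.
  have hΓ : ∀ i j l, ∑ k, gram g e y l k * christoffel g e k i j y =
      1 / 2 * (dGram g e i j l y + dGram g e j i l y - dGram g e l i j y) := by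
    intro i j l
    have h : (gram g e y).mulVec ((gram g e y)⁻¹.mulVec fun m ↦
        dGram g e i j m y + dGram g e j i m y - dGram g e m i j y) l =
        dGram g e i j l y + dGram g e j i l y - dGram g e l i j y := by
      rw [Matrix.mulVec_mulVec, Matrix.mul_nonsing_inv _ (isUnit_det_gram g he hy),
        Matrix.one_mulVec]
    rw [← h]
    simp only [Matrix.mulVec, dotProduct, christoffel, Finset.mul_sum]
    refine Finset.sum_congr rfl fun k _ ↦ Finset.sum_congr rfl fun m _ ↦ ?_
    ring
  have hexp : ∀ a b : Model n, ∀ l : Model n,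
      D a b l = ∑ i, ∑ j, a i * b j * D (EuclideanSpace.single i (1 : ℝ))
        (EuclideanSpace.single j (1 : ℝ)) l := by
    intro a b l
    conv_lhs => rw [model_eq_sum a]
    simp only [map_sum, map_smul, sum_apply, smul_apply, smul_eq_mul]
    refine Finset.sum_congr rfl fun i _ ↦ ?_
    rw [bilin_apply_eq_sum, Finset.mul_sum]
    exact Finset.sum_congr rfl fun j _ ↦ by ring
  have hbasis : ∀ l, chartForm g.inner e y
      (WithLp.toLp 2 fun k ↦ ∑ i, ∑ j, christoffel g e k i j y * u i * u j)
      (EuclideanSpace.single l (1 : ℝ)) = D u u (EuclideanSpace.single l (1 : ℝ)) -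
        1 / 2 * D (EuclideanSpace.single l (1 : ℝ)) u u := by
    intro l
    rw [← gram_mulVec_eq]
    have h1 : (gram g e y).mulVec
        (WithLp.toLp 2 fun k ↦ ∑ i, ∑ j, christoffel g e k i j y * u i * u j : Model n) l =
        ∑ i, ∑ j, u i * u j *
          (1 / 2 * (dGram g e i j l y + dGram g e j i l y - dGram g e l i j y)) := by
      simp only [Matrix.mulVec, dotProduct, Finset.mul_sum, ← hΓ]
      rw [Finset.sum_comm]
      refine Finset.sum_congr rfl fun i _ ↦ ?_
      rw [Finset.sum_comm]
      refine Finset.sum_congr rfl fun j _ ↦ Finset.sum_congr rfl fun k _ ↦ ?_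
      ring
    have h2 : D (EuclideanSpace.single l (1 : ℝ)) u u =
        ∑ i, ∑ j, u i * u j * dGram g e l i j y := by
      rw [bilin_apply_eq_sum]
      refine Finset.sum_congr rfl fun i _ ↦ ?_
      rw [bilin_apply_eq_sum_right, Finset.mul_sum]
      exact Finset.sum_congr rfl fun j _ ↦ by rw [dGram_eq g he hy]; ring
    have h3 : D u u (EuclideanSpace.single l (1 : ℝ)) =
        ∑ i, ∑ j, u i * u j * dGram g e i j l y := by
      rw [hexp]
      simp only [dGram_eq g he hy, hD]
    have h4 : D u u (EuclideanSpace.single l (1 : ℝ)) =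
        ∑ i, ∑ j, u i * u j * dGram g e j i l y := by
      rw [h3, Finset.sum_comm]
      exact Finset.sum_congr rfl fun i _ ↦ Finset.sum_congr rfl fun j _ ↦ by ring
    -- `D u u` is split into two copies, so that one can be matched with `∂ᵢ gⱼₗ` and the other,
    -- with the summation indices exchanged, with `∂ⱼ gᵢₗ`.
    have h5 : D u u (EuclideanSpace.single l (1 : ℝ)) -
        1 / 2 * D (EuclideanSpace.single l (1 : ℝ)) u u =
        1 / 2 * (D u u (EuclideanSpace.single l (1 : ℝ)) + D u u (EuclideanSpace.single l (1 : ℝ))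
          - D (EuclideanSpace.single l (1 : ℝ)) u u) := by ring
    rw [h1, h5, h2]
    nth_rewrite 1 [h3]
    rw [h4]
    simp only [← Finset.sum_add_distrib, ← Finset.sum_sub_distrib, Finset.mul_sum]
    exact Finset.sum_congr rfl fun i _ ↦ Finset.sum_congr rfl fun j _ ↦ by ring
  rw [model_eq_sum w]
  simp only [map_sum, map_smul, sum_apply, smul_apply, smul_eq_mul, hbasis, Finset.mul_sum,
    ← Finset.sum_sub_distrib]
  exact Finset.sum_congr rfl fun l _ ↦ by ring

/-- Pairing the component equation with `w` through the metric lowers the index: the Christoffel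
term becomes first derivatives of the metric and the Lorentz force becomes `σ(γ', w)`. -/
theorem MagneticSystem.IsMagneticGeodesicOn.isMagneticCurveOn {γ : ℝ → M} {J : Set ℝ}
    (hJ : IsOpen J) (h : S.IsMagneticGeodesicOn γ J) : S.IsMagneticCurveOn γ J := by
  have hC : ∀ t ∈ J, ContMDiffAt 𝓘(ℝ, ℝ) (𝓡 n) 2 γ t := fun t ht ↦
    (h.1.contMDiffAt (hJ.mem_nhds ht)).of_le ENat.LEInfty.out
  refine ⟨hC, fun t ht e he hte w ↦ ?_⟩
  have hy := e.map_source hte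
  have hx := (hC t ht).contDiffAt_chart he hte
  have hcoord : ∀ k, ∀ᶠ s in 𝓝 t, deriv (fun s ↦ e (γ s) k) s = deriv (fun s ↦ e (γ s)) s k := by
    intro k
    filter_upwards [hx.eventually (by simp)] with s hs
    exact ((EuclideanSpace.proj (𝕜 := ℝ) k).hasFDerivAt.comp_hasDerivAt s
      (hs.differentiableAt (by simp)).hasDerivAt).deriv
  have hcoord2 : ∀ k, deriv (deriv (fun s ↦ e (γ s) k)) t =
      deriv (deriv fun s ↦ e (γ s)) t k := by
    intro k
    rw [Filter.EventuallyEq.deriv_eq (hcoord k)]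
    exact ((EuclideanSpace.proj (𝕜 := ℝ) k).hasFDerivAt.comp_hasDerivAt t
      (((hx.fderiv_right (m := 1) (by norm_num)).differentiableAt (by norm_num)).clm_apply
        (differentiableAt_const (1 : ℝ))).hasDerivAt).deriv
  set u := deriv (fun s ↦ e (γ s)) t with hu
  set b := deriv (deriv fun s ↦ e (γ s)) t with hb
  have hcov : covAccel S.metric e γ t = b + (WithLp.toLp 2 fun k ↦
      ∑ i, ∑ j, christoffel S.metric e k i j (e (γ t)) * u i * u j) := by
    ext k
    simp only [covAccel, hcoord2, fun k ↦ (hcoord k).self_of_nhds]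
    rfl
  have hmain := h.2 t ht e he hte
  rw [hcov] at hmain
  have hchr := chartForm_christoffel S.metric he hy u w
  have hmd := mdifferentiable_of_mem_maximalAtlas he
  have hsymm : ∀ v : Model n,
      (mfderiv (𝓡 n) (𝓡 n) e.symm (e (γ t)) (mfderiv (𝓡 n) (𝓡 n) e (γ t) v) : Model n) = v :=
    fun v ↦ congrArg (fun L : Model n →L[ℝ] Model n ↦ L v) (hmd.symm_comp_deriv hte)
  have hvel : u = mfderiv (𝓡 n) (𝓡 n) e (γ t) (mfderiv 𝓘(ℝ, ℝ) (𝓡 n) γ t (1 : ℝ)) := by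
    have h1 : mfderiv 𝓘(ℝ, ℝ) (𝓡 n) (e ∘ γ) t = _ := mfderiv_comp t (hmd.mdifferentiableAt hte)
      ((hC t ht).mdifferentiableAt (by simp))
    rw [mfderiv_eq_fderiv] at h1
    exact congrArg (fun L : ℝ →L[ℝ] Model n ↦ L 1) h1
  have hcongr : ∀ (B : ∀ x : M, TangentSpace (𝓡 n) x →L[ℝ] TangentSpace (𝓡 n) x →L[ℝ] ℝ)
      (q q' : M), q = q' → ∀ a b : Model n,
      (B q : Model n →L[ℝ] Model n →L[ℝ] ℝ) a b = (B q' : Model n →L[ℝ] Model n →L[ℝ] ℝ) a b := by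
    rintro B q _ rfl a b; rfl
  have hforce : chartForm S.metric.inner e (e (γ t)) (mfderiv (𝓡 n) (𝓡 n) e (γ t)
      (S.lorentzForce (γ t) (mfderiv 𝓘(ℝ, ℝ) (𝓡 n) γ t (1 : ℝ)))) w =
      chartForm S.form e (e (γ t)) u w := by
    rw [hvel]
    refine (hcongr S.metric.inner _ (γ t) (e.left_inv hte) _ _).trans
      (Eq.trans ?_ (hcongr S.form _ (γ t) (e.left_inv hte) _ _).symm)
    erw [hsymm, hsymm]
    exact S.metric_lorentzForce _ _ _
  have hfin := congrArg (fun v ↦ chartForm S.metric.inner e (e (γ t)) v w) hmain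
  simp only [map_add, add_apply] at hfin
  rw [hchr, hforce] at hfin
  unfold magneticResidual
  linarith

end Christoffel

end MagneticCurves

/-! ### Quantitative and smooth inverse function arguments -/

section Analysis

variable {E : Type*} [NormedAddCommGroup E] [NormedSpace ℝ E]

/-- The inverse function theorem for a smooth map on an open set, with a smooth inverse. -/
theorem exists_smooth_openPartialHomeomorph [CompleteSpace E] {f : E → E} {Ω : Set E} {x₀ : E}
    (hΩ : IsOpen Ω) (hf : ContDiffOn ℝ ∞ f Ω) (hx₀ : x₀ ∈ Ω)
    (hd : HasFDerivAt f (ContinuousLinearMap.id ℝ E) x₀) :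
    ∃ h : OpenPartialHomeomorph E E, x₀ ∈ h.source ∧ h.source ⊆ Ω ∧ (∀ x, h x = f x) ∧
      ContDiffOn ℝ ∞ h h.source ∧ ContDiffOn ℝ ∞ h.symm h.target := by
  have hfx : ContDiffAt ℝ ∞ f x₀ := hf.contDiffAt (hΩ.mem_nhds hx₀)
  have hd' : HasFDerivAt f ((ContinuousLinearEquiv.refl ℝ E : E ≃L[ℝ] E) : E →L[ℝ] E) x₀ := hd
  set h₀ := hfx.toOpenPartialHomeomorph f hd' (by simp) with hh₀
  have hcoe : ∀ x, h₀ x = f x := fun x ↦ rfl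
  -- Restricting to the open set of points with invertible derivative makes the inverse smooth on
  -- its whole domain, and not only at the image of `x₀`.
  set Ω' := Ω ∩ fderiv ℝ f ⁻¹' range ((↑) : (E ≃L[ℝ] E) → E →L[ℝ] E) with hΩ'
  have hopen : IsOpen Ω' :=
    (hf.continuousOn_fderiv_of_isOpen hΩ (by simp)).isOpen_inter_preimage hΩ
      ContinuousLinearEquiv.isOpen
  have hmem : x₀ ∈ Ω' := ⟨hx₀, ContinuousLinearEquiv.refl ℝ E, hd.fderiv.symm⟩
  refine ⟨h₀.restrOpen Ω' hopen, ⟨hfx.mem_toOpenPartialHomeomorph_source hd' (by simp), hmem⟩,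
    fun x hx ↦ hx.2.1, hcoe, hf.mono fun x hx ↦ hx.2.1, fun y hy ↦ ?_⟩
  have hsrc := (h₀.restrOpen Ω' hopen).map_target hy
  obtain ⟨Φ, hΦ⟩ := hsrc.2.2
  have hfy : ContDiffAt ℝ ∞ f (h₀.symm y) := hf.contDiffAt (hΩ.mem_nhds hsrc.2.1)
  refine ((h₀.restrOpen Ω' hopen).contDiffAt_symm hy (f₀' := Φ) ?_ hfy).contDiffWithinAt
  rw [hΦ]
  exact (hfy.differentiableAt (by simp)).hasFDerivAt

/-- `R` inverts `T` on a complement of its kernel, so that `x - R (T x)` is a projection of `x` to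
the kernel. -/
theorem exists_projection_of_ker {F : Type*} [AddCommGroup F] [Module ℝ F] (T : E →ₗ[ℝ] F) :
    ∃ R : F →ₗ[ℝ] E, ∀ x, T (x - R (T x)) = 0 := by
  obtain ⟨W, hW⟩ := Submodule.exists_isCompl (LinearMap.ker T)
  have hinj : LinearMap.ker (T.domRestrict W) = ⊥ := by
    rw [LinearMap.ker_eq_bot']
    intro x hx
    exact Subtype.ext (Submodule.disjoint_def.1 hW.disjoint x hx x.2)
  obtain ⟨R, hR⟩ := LinearMap.exists_leftInverse_of_injective _ hinj
  refine ⟨W.subtype ∘ₗ R, fun x ↦ ?_⟩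
  obtain ⟨k, hk, w, hw, rfl⟩ := Submodule.mem_sup.1 (hW.sup_eq_top ▸ Submodule.mem_top (x := x))
  have h1 : R (T w) = ⟨w, hw⟩ := LinearMap.congr_fun hR ⟨w, hw⟩
  simp [LinearMap.mem_ker.1 hk, h1]

/-- A self-map of a ball of a subspace that is close to the identity covers a neighbourhood of
the image of the centre. -/
theorem exists_ball_subset_image [CompleteSpace E] {W : Submodule ℝ E} [CompleteSpace W]
    {f : E → E} {r : ℝ} {T : ℝ} {c : NNReal} (hr : 0 < r) (hT : 0 < T) (hc1 : c < 1)
    (hfW : ∀ v ∈ W, v ∈ Metric.closedBall (0 : E) r → f v ∈ W) (hf0 : f 0 = 0)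
    (hf : ∀ v ∈ Metric.closedBall (0 : E) r, ∀ w ∈ Metric.closedBall (0 : E) r,
      ‖f v - f w - T • (v - w)‖ ≤ c * T * ‖v - w‖) :
    ∃ ρ > (0 : ℝ), ∀ w ∈ W, w ∈ Metric.ball (0 : E) ρ →
      ∃ v ∈ W, v ∈ Metric.closedBall (0 : E) r ∧ f v = w := by
  classical
  -- The rescaled map `T⁻¹ • f` as a self-map of `W`. The value `0` is never used, because `f`
  -- preserves `W` on the ball.
  let g : W → W := fun v ↦ if h : f v ∈ W then T⁻¹ • ⟨f v, h⟩ else 0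
  have hg : ∀ v : W, v ∈ Metric.closedBall (0 : W) r → (g v : E) = T⁻¹ • f v := by
    intro v hv
    have : f v ∈ W := hfW v v.2 (by simpa using hv)
    simp [g, this]
  have happrox : ApproximatesLinearOn g (ContinuousLinearMap.id ℝ W)
      (Metric.closedBall (0 : W) r) c := by
    intro v hv w hw
    have h := hf v (by simpa using hv) w (by simpa using hw)
    have h1 : ((g v - g w - (v - w) : W) : E) = T⁻¹ • (f v - f w - T • ((v : E) - w)) := by
      push_cast
      rw [hg v hv, hg w hw, smul_sub T⁻¹ (f v - f w), smul_smul, inv_mul_cancel₀ hT.ne', one_smul,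
        smul_sub]
    show ‖((g v - g w - (v - w) : W) : E)‖ ≤ c * ‖(v : E) - w‖
    rw [h1, norm_smul, norm_inv, Real.norm_of_nonneg hT.le, inv_mul_le_iff₀ hT]
    exact h.trans_eq (by ring)
  let idinv : (ContinuousLinearMap.id ℝ W).NonlinearRightInverse :=
    { toFun := id, nnnorm := 1, bound' := by simp, right_inv' := by simp }
  have hsurj := happrox.surjOn_closedBall_of_nonlinearRightInverse idinv (b := 0) hr.le le_rfl
  have hg0 : g 0 = 0 := by
    apply Subtype.ext
    rw [hg 0 (by simp [hr.le])]
    simp [hf0]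
  rw [hg0] at hsurj
  have hc1' : (0 : ℝ) < 1 - c := sub_pos.2 hc1
  -- A map that is `c`-close to the identity on the ball of radius `r` covers the ball of radius `(1
  -- - c) * r`; the factor `T` undoes the rescaling.
  refine ⟨T * ((1 - c) * r), by positivity, fun w hw hwb ↦ ?_⟩
  obtain ⟨v, hv, hvw⟩ := hsurj (a := T⁻¹ • ⟨w, hw⟩) (by
    rw [mem_closedBall_zero_iff, norm_smul, norm_inv, Real.norm_of_nonneg hT.le,
      inv_mul_le_iff₀ hT]
    simpa [idinv] using (mem_ball_zero_iff.1 hwb).le)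
  refine ⟨v, v.2, by simpa using hv, ?_⟩
  have h1 := hg v hv
  rw [hvw] at h1
  exact (smul_right_injective E (inv_ne_zero hT.ne') h1).symm

end Analysis

/-! ### Magnetic curves with fixed initial data -/

section FixedPoints

variable {n : ℕ} {M : Type*} [TopologicalSpace M] [ChartedSpace (Model n) M]
  {e : OpenPartialHomeomorph M (Model n)}
  {F : M ≃ₘ⟮𝓡 n, 𝓡 n⟯ M} {𝓜 : Set (M ≃ₘ⟮𝓡 n, 𝓡 n⟯ M)} {p : M}

/-- The vectors, in the chart `e` at `p`, fixed by the differentials of all the elements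
of `𝓜`. -/
def fixedVectors (e : OpenPartialHomeomorph M (Model n)) (𝓜 : Set (M ≃ₘ⟮𝓡 n, 𝓡 n⟯ M)) (p : M) :
    Submodule ℝ (Model n) :=
  ⨅ F : 𝓜, LinearMap.ker
    ((fderiv ℝ (localRep e e F) (e p)).toLinearMap - LinearMap.id)

theorem mem_fixedVectors {v : Model n} : v ∈ fixedVectors e 𝓜 p ↔
    ∀ F ∈ 𝓜, fderiv ℝ (localRep e e F) (e p) v = v := by
  simp [fixedVectors, Submodule.mem_iInf, sub_eq_zero]

variable [IsManifold (𝓡 n) ∞ M] {S : MagneticSystem n M}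

namespace MagneticSystem

/-- The regularity comes from bootstrapping: `u'` is continuous by the equation, so `u` is `C¹` and
`x` is `C²`. -/
theorem isMagneticCurveOn_symm_comp (he : e ∈ IsManifold.maximalAtlas (𝓡 n) ∞ M)
    {J : Set ℝ} (hJ : IsOpen J) {x u : ℝ → Model n} (hxe : ∀ t ∈ J, x t ∈ e.target)
    (hx : ∀ t ∈ J, HasDerivAt x (u t) t)
    (hu : ∀ t ∈ J, HasDerivAt u (S.chartAccel e (x t, u t)) t) :
    S.IsMagneticCurveOn (fun t ↦ e.symm (x t)) J := by
  have hcx : ContinuousOn x J := fun t ht ↦ (hx t ht).continuousAt.continuousWithinAt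
  have hcu : ContinuousOn u J := fun t ht ↦ (hu t ht).continuousAt.continuousWithinAt
  have hu1 : ContDiffOn ℝ 1 u J := by
    rw [show (1 : WithTop ℕ∞) = 0 + 1 from rfl, contDiffOn_succ_iff_deriv_of_isOpen hJ]
    refine ⟨fun t ht ↦ (hu t ht).differentiableAt.differentiableWithinAt, by simp, ?_⟩
    rw [contDiffOn_zero]
    refine ContinuousOn.congr (f := fun t ↦ S.chartAccel e (x t, u t)) (fun t ht ↦ ?_)
      fun t ht ↦ (hu t ht).deriv
    have h1 : ContinuousAt (S.chartAccel e) (x t, u t) :=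
      (contDiffAt_chartAccel he (z := (x t, u t)) (hxe t ht)).continuousAt
    exact (h1.comp (f := fun t ↦ (x t, u t))
      ((hx t ht).continuousAt.prodMk (hu t ht).continuousAt)).continuousWithinAt
  have hx2 : ContDiffOn ℝ 2 x J := by
    rw [show (2 : WithTop ℕ∞) = 1 + 1 from by norm_num, contDiffOn_succ_iff_deriv_of_isOpen hJ]
    exact ⟨fun t ht ↦ (hx t ht).differentiableAt.differentiableWithinAt, by simp,
      hu1.congr fun t ht ↦ (hx t ht).deriv⟩
  have hev : ∀ t ∈ J, (fun s ↦ e (e.symm (x s))) =ᶠ[𝓝 t] x := fun t ht ↦ by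
    filter_upwards [hJ.mem_nhds ht] with s hs using e.right_inv (hxe s hs)
  have hdx : ∀ t ∈ J, deriv x =ᶠ[𝓝 t] u := fun t ht ↦ by
    filter_upwards [hJ.mem_nhds ht] with s hs using (hx s hs).deriv
  refine isMagneticCurveOn_of_chart he (fun t ht ↦ e.map_target (hxe t ht)) (fun t ht ↦ ?_)
    fun t ht ↦ ?_
  · have h1 : ContMDiffAt (𝓡 n) (𝓡 n) 2 e.symm (x t) :=
      ((contMDiffOn_symm_of_mem_maximalAtlas he).contMDiffAt
        (e.open_target.mem_nhds (hxe t ht))).of_le ENat.LEInfty.out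
    exact h1.comp t (hx2.contDiffAt (hJ.mem_nhds ht)).contMDiffAt
  · rw [magneticEqAt_iff he (e.map_target (hxe t ht)), (hev t ht).deriv.deriv_eq,
      (hev t ht).deriv_eq, (hdx t ht).deriv_eq, (hdx t ht).self_of_nhds, e.right_inv (hxe t ht)]
    exact (hu t ht).deriv

/-- A magnetic curve whose initial velocity is fixed by a magnetomorphism consists of fixed
points of it. -/
theorem IsMagneticCurveOn.fixed [T2Space M] {γ : ℝ → M} {J : Set ℝ}
    (h : S.IsMagneticCurveOn γ J) (hJ : IsOpen J) (hJ' : IsPreconnected J) (h0 : (0 : ℝ) ∈ J)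
    (hF : F ∈ S.Mag) (hp : F (γ 0) = γ 0)
    (hv : mfderiv (𝓡 n) (𝓡 n) F (γ 0) (mfderiv 𝓘(ℝ, ℝ) (𝓡 n) γ 0 (1 : ℝ)) =
      (mfderiv 𝓘(ℝ, ℝ) (𝓡 n) γ 0 (1 : ℝ) : Model n)) :
    ∀ t ∈ J, F (γ t) = γ t := by
  have he := IsManifold.chart_mem_maximalAtlas (I := 𝓡 n) (n := ∞) (γ 0)
  have hmd := mdifferentiable_of_mem_maximalAtlas he
  have hγ : MDifferentiableAt 𝓘(ℝ, ℝ) (𝓡 n) γ 0 := (h.contMDiffAt 0 h0).mdifferentiableAt (by simp)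
  have hFd : MDifferentiableAt (𝓡 n) (𝓡 n) F (γ 0) :=
    F.contMDiff.contMDiffAt.mdifferentiableAt (by simp)
  have hcongr : ∀ q : M, q = γ 0 → ∀ a b : Model n, a = b →
      (mfderiv (𝓡 n) (𝓡 n) (chartAt (Model n) (γ 0)) q a : Model n) =
      mfderiv (𝓡 n) (𝓡 n) (chartAt (Model n) (γ 0)) (γ 0) b := by
    rintro q rfl a _ rfl; rfl
  refine fun t ht ↦ ((h.eqOn hJ hJ' (h.map hF) h0 hp.symm he (mem_chart_source _ _) ?_) ht).symm
  have h1 : mfderiv 𝓘(ℝ, ℝ) (𝓡 n) (chartAt (Model n) (γ 0) ∘ γ) 0 = _ :=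
    mfderiv_comp 0 (hmd.mdifferentiableAt (mem_chart_source _ _)) hγ
  have h2 : mfderiv 𝓘(ℝ, ℝ) (𝓡 n) (chartAt (Model n) (γ 0) ∘ (F ∘ γ)) 0 = _ :=
    mfderiv_comp 0 (hmd.mdifferentiableAt (by simp [hp])) (hFd.comp 0 hγ)
  rw [mfderiv_comp 0 hFd hγ, mfderiv_eq_fderiv] at h2
  rw [mfderiv_eq_fderiv] at h1
  refine (congrArg (fun L : ℝ →L[ℝ] Model n ↦ L 1) h1).trans (Eq.trans ?_
    (congrArg (fun L : ℝ →L[ℝ] Model n ↦ L 1) h2).symm)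
  exact (hcongr (F (γ 0)) hp _ _ hv).symm

end MagneticSystem

/-- Magnetic curves issuing from a common fixed point with a small fixed velocity consist of
common fixed points. -/
theorem symm_mem_fixedPoints [T2Space M] (h𝓜 : 𝓜 ⊆ S.Mag) (hp : p ∈ fixedPoints 𝓜)
    (he : e ∈ IsManifold.maximalAtlas (𝓡 n) ∞ M) (hpe : p ∈ e.source) {δ : ℝ} (hδ : 0 < δ)
    {x u : ℝ → Model n} (hxe : ∀ t ∈ Ioo (-δ) δ, x t ∈ e.target)
    (hx : ∀ t ∈ Ioo (-δ) δ, HasDerivAt x (u t) t)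
    (hu : ∀ t ∈ Ioo (-δ) δ, HasDerivAt u (S.chartAccel e (x t, u t)) t)
    (hx0 : x 0 = e p) (hu0 : u 0 ∈ fixedVectors e 𝓜 p) :
    ∀ t ∈ Ioo (-δ) δ, e.symm (x t) ∈ fixedPoints 𝓜 := by
  intro t ht F hF
  have h0 : (0 : ℝ) ∈ Ioo (-δ) δ := ⟨by linarith, hδ⟩
  have hc := S.isMagneticCurveOn_symm_comp he isOpen_Ioo hxe hx hu
  have hγ0 : e.symm (x 0) = p := by rw [hx0, e.left_inv hpe]
  have hFγ : F (e.symm (x 0)) = e.symm (x 0) := by rw [hγ0]; exact hp F hF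
  have hFs : F (e.symm (x 0)) ∈ e.source := by rwa [hFγ, hγ0]
  refine hc.fixed isOpen_Ioo isPreconnected_Ioo h0 (h𝓜 hF) hFγ ?_ t ht
  have hvel : mfderiv 𝓘(ℝ, ℝ) (𝓡 n) (e.symm ∘ x) 0 = _ := mfderiv_comp 0
    ((mdifferentiable_of_mem_maximalAtlas he).mdifferentiableAt_symm (hxe 0 h0))
    (hx 0 h0).differentiableAt.mdifferentiableAt
  have hvel' : (mfderiv 𝓘(ℝ, ℝ) (𝓡 n) (e.symm ∘ x) 0 (1 : ℝ) : Model n) =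
      mfderiv (𝓡 n) (𝓡 n) e.symm (x 0) (u 0) := by
    have hx' : (mfderiv 𝓘(ℝ, ℝ) (𝓡 n) x 0 (1 : ℝ) : Model n) = u 0 := by
      rw [mfderiv_eq_fderiv]
      exact (hx 0 h0).deriv
    exact (congrArg (fun L : ℝ →L[ℝ] Model n ↦ L 1) hvel).trans
      (congrArg (fun w : Model n ↦ (mfderiv (𝓡 n) (𝓡 n) e.symm (x 0) w : Model n)) hx')
  have hlr : localRep e e F (x 0) = x 0 := by
    rw [localRep, hFγ, e.right_inv (hxe 0 h0)]
  have h1 := mfderiv_symm_fderiv_localRep he he (hxe 0 h0) hFs (u 0)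
  have h2 : fderiv ℝ (localRep e e F) (x 0) (u 0) = u 0 := by
    rw [hx0]; exact mem_fixedVectors.1 hu0 F hF
  rw [h2, hlr] at h1
  refine Eq.trans ?_ (h1.symm.trans hvel'.symm)
  exact congrArg (fun w : Model n ↦ (mfderiv (𝓡 n) (𝓡 n) F (e.symm (x 0)) w : Model n)) hvel'

end FixedPoints

/-! ### Slice charts of the fixed-point set -/

section SliceCharts

variable {n : ℕ} {M : Type*} [TopologicalSpace M] [ChartedSpace (Model n) M]
  {e : OpenPartialHomeomorph M (Model n)}
  {𝓜 : Set (M ≃ₘ⟮𝓡 n, 𝓡 n⟯ M)} {p : M}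

theorem trans_mem_maximalAtlas [IsManifold (𝓡 n) ∞ M]
    (he : e ∈ IsManifold.maximalAtlas (𝓡 n) ∞ M)
    {h : OpenPartialHomeomorph (Model n) (Model n)} (hh : ContDiffOn ℝ ∞ h h.source)
    (hh' : ContDiffOn ℝ ∞ h.symm h.target) :
    e ≫ₕ h ∈ IsManifold.maximalAtlas (𝓡 n) ∞ M := by
  rw [IsManifold.mem_maximalAtlas_iff_contMDiffOn]
  refine ⟨?_, ?_⟩
  · exact hh.contMDiffOn.comp ((contMDiffOn_of_mem_maximalAtlas he).mono fun x hx ↦ hx.1)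
      fun x hx ↦ hx.2
  · exact (contMDiffOn_symm_of_mem_maximalAtlas he).comp
      (hh'.contMDiffOn.mono fun x hx ↦ hx.1) fun x hx ↦ hx.2

theorem restrOpen_mem_maximalAtlas [IsManifold (𝓡 n) ∞ M]
    (he : e ∈ IsManifold.maximalAtlas (𝓡 n) ∞ M) {s : Set M} (hs : IsOpen s) :
    e.restrOpen s hs ∈ IsManifold.maximalAtlas (𝓡 n) ∞ M := by
  rw [IsManifold.mem_maximalAtlas_iff_contMDiffOn]
  exact ⟨(contMDiffOn_of_mem_maximalAtlas he).mono fun x hx ↦ hx.1,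
    (contMDiffOn_symm_of_mem_maximalAtlas he).mono fun x hx ↦ by
      simp only [OpenPartialHomeomorph.restrOpen] at hx; exact hx.1⟩

/-- Coordinates near the point with coordinates `e p`, tangent to `e` there, in which the common
fixed points lie in the subspace of fixed vectors. -/
theorem exists_straightening (hp : p ∈ fixedPoints 𝓜)
    (he : e ∈ IsManifold.maximalAtlas (𝓡 n) ∞ M) (hpe : p ∈ e.source) :
    ∃ h : OpenPartialHomeomorph (Model n) (Model n), e p ∈ h.source ∧ h.source ⊆ e.target ∧
      ContDiffOn ℝ ∞ h h.source ∧ ContDiffOn ℝ ∞ h.symm h.target ∧ h (e p) = 0 ∧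
      HasStrictFDerivAt h (ContinuousLinearMap.id ℝ (Model n)) (e p) ∧
      ∀ y ∈ h.source, e.symm y ∈ fixedPoints 𝓜 → h y ∈ fixedVectors e 𝓜 p := by
  classical
  -- Subspaces of the model space satisfy the descending chain condition, so finitely many elements
  -- of an arbitrary `𝓜` already cut out the fixed vectors.
  obtain ⟨s, hs⟩ := Finset.exists_inf_le fun F : 𝓜 ↦ LinearMap.ker
    ((fderiv ℝ (localRep e e F) (e p)).toLinearMap - LinearMap.id)
  let T : Model n →L[ℝ] (s → Model n) := ContinuousLinearMap.pi fun F ↦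
    fderiv ℝ (localRep e e F.1) (e p) - ContinuousLinearMap.id ℝ (Model n)
  have hT : ∀ v, T v = 0 → v ∈ fixedVectors e 𝓜 p := by
    intro v hv
    refine (Submodule.mem_iInf _).2 fun F ↦ hs F ?_
    refine (Submodule.mem_finsetInf).2 fun i hi ↦ ?_
    exact congrFun hv ⟨i, hi⟩
  obtain ⟨R', hR'⟩ := exists_projection_of_ker T.toLinearMap
  let R : (s → Model n) →L[ℝ] Model n := R'.toContinuousLinearMap
  have hR : ∀ x, T (x - R (T x)) = 0 := hR'
  let Ψ : Model n → (s → Model n) := fun y F ↦ localRep e e F.1 y - y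
  -- At a fixed point `Ψ` vanishes and only the projection to the kernel of `T` remains. The
  -- derivative of `Ψ` at `e p` is `T`, so the correction `R (Ψ y)` restores the identity as
  -- derivative of `φ`.
  let φ : Model n → Model n := fun y ↦ (y - e p) - R (T (y - e p)) + R (Ψ y)
  let Ω : Set (Model n) := ⋂ F : s,
    (e.target ∩ (fun y ↦ (F.1 : M ≃ₘ⟮𝓡 n, 𝓡 n⟯ M) (e.symm y)) ⁻¹' e.source)
  have hΩ : IsOpen (e.target ∩ Ω) := by
    refine e.open_target.inter (isOpen_iInter_of_finite fun F ↦ ?_)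
    exact ((F.1.1.continuous.comp_continuousOn e.continuousOn_symm).isOpen_inter_preimage
      e.open_target e.open_source)
  have hfix : ∀ F : s, (F.1 : M ≃ₘ⟮𝓡 n, 𝓡 n⟯ M) (e.symm (e p)) = p := fun F ↦ by
    rw [e.left_inv hpe]; exact hp F.1 F.1.2
  have hmem : e p ∈ e.target ∩ Ω := ⟨e.map_source hpe, mem_iInter.2 fun F ↦
    ⟨e.map_source hpe, by simpa only [mem_preimage, hfix F] using hpe⟩⟩
  have hloc : ∀ F : s, ∀ y ∈ e.target ∩ Ω, ContDiffAt ℝ ∞ (localRep e e F.1) y := fun F y hy ↦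
    contDiffAt_localRep he he hy.1 (mem_iInter.1 hy.2 F).2
  have hΨ : ∀ y ∈ e.target ∩ Ω, ContDiffAt ℝ ∞ Ψ y := fun y hy ↦
    contDiffAt_pi.2 fun F ↦ (hloc F y hy).sub contDiffAt_id
  have hφ : ContDiffOn ℝ ∞ φ (e.target ∩ Ω) := by
    intro y hy
    have h1 : ContDiffAt ℝ ∞ (fun y ↦ y - e p) y := contDiffAt_id.sub contDiffAt_const
    exact ((h1.sub ((R.comp T).contDiff.contDiffAt.comp y h1)).add
      (R.contDiff.contDiffAt.comp y (hΨ y hy))).contDiffWithinAt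
  have hdφ : HasFDerivAt φ (ContinuousLinearMap.id ℝ (Model n)) (e p) := by
    have h1 : HasFDerivAt (fun y ↦ y - e p) (ContinuousLinearMap.id ℝ (Model n)) (e p) :=
      (hasFDerivAt_id _).sub_const _
    have h2 : HasFDerivAt Ψ T (e p) := hasFDerivAt_pi.2 fun F ↦
      ((hloc F _ hmem).differentiableAt (by simp)).hasFDerivAt.sub (hasFDerivAt_id _)
    have h3 := (h1.sub ((R.comp T).hasFDerivAt.comp (e p) h1)).add
      (R.hasFDerivAt.comp (e p) h2)
    refine h3.congr_fderiv ?_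
    ext v
    simp
  obtain ⟨h, h1, h2, h3, h4, h5⟩ := exists_smooth_openPartialHomeomorph hΩ hφ hmem hdφ
  have hΨ0 : ∀ y ∈ e.target, e.symm y ∈ fixedPoints 𝓜 → Ψ y = 0 := by
    intro y hy hfy
    funext F
    simp only [Ψ, localRep, hfy F.1 F.1.2, e.right_inv hy, sub_self, Pi.zero_apply]
  have hheq : (h : Model n → Model n) = φ := funext h3
  refine ⟨h, h1, fun y hy ↦ (h2 hy).1, h4, h5, ?_, ?_, fun y hy hfy ↦ ?_⟩
  · rw [h3]
    simp only [φ, hΨ0 _ hmem.1 (by rwa [e.left_inv hpe]), sub_self, map_zero, add_zero]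
  · rw [hheq]
    exact (hφ.contDiffAt (hΩ.mem_nhds hmem)).hasStrictFDerivAt' hdφ (by simp)
  · rw [h3]
    refine hT _ ?_
    simp only [φ, hΨ0 y (h2 hy).1 hfy, map_zero, add_zero]
    exact hR _

variable [IsManifold (𝓡 n) ∞ M] {S : MagneticSystem n M}

/-- The straightening puts fixed points into `W`, and the exponential map shows that every small
vector of `W` comes from a fixed point. The connectedness of the fixed set within the chart allows
the slice to be used for a single component. -/
theorem exists_slice_chart [T2Space M] (h𝓜 : 𝓜 ⊆ S.Mag) (hp : p ∈ fixedPoints 𝓜) :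
    ∃ e ∈ IsManifold.maximalAtlas (𝓡 n) ∞ M, p ∈ e.source ∧ ∃ W : Submodule ℝ (Model n),
      (∀ x ∈ e.source, x ∈ fixedPoints 𝓜 ↔ e x ∈ W) ∧
      IsPreconnected (fixedPoints 𝓜 ∩ e.source) := by
  have he := IsManifold.chart_mem_maximalAtlas (I := 𝓡 n) (n := ∞) p
  have hpe := mem_chart_source (Model n) p
  set e := chartAt (Model n) p with hedef
  obtain ⟨h, hph, hhe, hh, hh', hh0, hhd, hhW⟩ := exists_straightening hp he hpe
  obtain ⟨U, hU, happ⟩ := hhd.approximates_deriv_on_nhds (c := 1 / 4) (Or.inr (by norm_num))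
  obtain ⟨δ, hδ, T, hT, hTδ, r, hr, X, X', hX, hXapp, hX0⟩ := exists_secondOrder_exp
    (a := S.chartAccel e) (p := e p)
    ((MagneticSystem.contDiffAt_chartAccel he (z := (e p, 0)) (e.map_source hpe)).of_le (by simp))
    (magneticAccel_zero _ _ _) (Filter.inter_mem hU (h.open_source.mem_nhds hph))
    (c := 1 / 4) (by norm_num)
  have hTmem : (T : ℝ) ∈ Ioo (-δ) δ := ⟨by linarith [T.2, NNReal.coe_nonneg T], hTδ⟩
  have hXfix : ∀ v ∈ fixedVectors e 𝓜 p, v ∈ Metric.closedBall (0 : Model n) r →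
      e.symm (X v T) ∈ fixedPoints 𝓜 := fun v hv hvr ↦
    symm_mem_fixedPoints h𝓜 hp he hpe hδ
      (fun t ht ↦ hhe ((hX v hvr).2.2 t ht).1.2) (fun t ht ↦ ((hX v hvr).2.2 t ht).2.1)
      (fun t ht ↦ ((hX v hvr).2.2 t ht).2.2) (hX v hvr).1
      (by rw [(hX v hvr).2.1]; exact hv) T hTmem
  -- The coordinate change contributes `1/4` of `‖X v T - X w T‖`, which is at most `5/4 * T * ‖v -
  -- w‖`, and the exponential map contributes `1/4`. The sum `9/16` is below `5/8`.
  obtain ⟨ρ, hρ, hsurj⟩ := exists_ball_subset_image (W := fixedVectors e 𝓜 p)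
    (f := fun v ↦ h (X v T)) (r := r) (T := T) (c := 5 / 8) hr hT
    (by rw [← NNReal.coe_lt_coe]; norm_num)
    (fun v hv hvr ↦ hhW _ ((hX v hvr).2.2 T hTmem).1.2 (hXfix v hv hvr))
    (by simp only [hX0, hh0])
    (fun v hv w hw ↦ by
      have h1 := happ _ ((hX v hv).2.2 T hTmem).1.1 _ ((hX w hw).2.2 T hTmem).1.1
      have h2 := hXapp v hv w hw
      have h3 : ‖X v T - X w T‖ ≤ 5 / 4 * T * ‖v - w‖ := by
        have h4 : ‖(T : ℝ) • (v - w)‖ = T * ‖v - w‖ := by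
          rw [norm_smul, Real.norm_of_nonneg (NNReal.coe_nonneg T)]
        have h5 := norm_add_le (X v T - X w T - (T : ℝ) • (v - w)) ((T : ℝ) • (v - w))
        rw [sub_add_cancel, h4] at h5
        push_cast at h2
        linarith
      have h6 := norm_add_le (h (X v T) - h (X w T) - (X v T - X w T))
        (X v T - X w T - (T : ℝ) • (v - w))
      rw [sub_add_sub_cancel] at h6
      rw [ContinuousLinearMap.id_apply] at h1
      push_cast at h1 h2 ⊢
      have h7 : (0 : ℝ) ≤ T * ‖v - w‖ := by positivity
      linarith)
  have hfix : ∀ w ∈ fixedVectors e 𝓜 p, w ∈ Metric.ball (0 : Model n) ρ →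
      w ∈ h.target ∧ h.symm w ∈ e.target ∧ e.symm (h.symm w) ∈ fixedPoints 𝓜 := by
    intro w hw hwρ
    obtain ⟨v, hv, hvr, rfl⟩ := hsurj w hw hwρ
    have hXv := ((hX v hvr).2.2 T hTmem).1.2
    refine ⟨h.map_source hXv, ?_, ?_⟩
    · rw [h.left_inv hXv]; exact hhe hXv
    · rw [h.left_inv hXv]; exact hXfix v hv hvr
  set e₁ := e ≫ₕ h with he₁
  have hV : IsOpen (e₁.source ∩ e₁ ⁻¹' Metric.ball (0 : Model n) ρ) :=
    e₁.isOpen_inter_preimage Metric.isOpen_ball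
  have hsrc : ∀ x, x ∈ (e₁.restrOpen _ hV).source ↔
      x ∈ e.source ∧ e x ∈ h.source ∧ h (e x) ∈ Metric.ball (0 : Model n) ρ := by
    intro x
    simp only [OpenPartialHomeomorph.restrOpen_source, he₁, OpenPartialHomeomorph.trans_source,
      mem_inter_iff, mem_preimage, OpenPartialHomeomorph.coe_trans, Function.comp_apply]
    tauto
  have hW : ∀ x ∈ (e₁.restrOpen _ hV).source,
      x ∈ fixedPoints 𝓜 ↔ h (e x) ∈ fixedVectors e 𝓜 p := by
    intro x hx
    obtain ⟨hx1, hx2, hx3⟩ := (hsrc x).1 hx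
    refine ⟨fun hfx ↦ hhW _ hx2 (by rwa [e.left_inv hx1]), fun hw ↦ ?_⟩
    have := (hfix _ hw hx3).2.2
    rwa [h.left_inv hx2, e.left_inv hx1] at this
  refine ⟨e₁.restrOpen _ hV, restrOpen_mem_maximalAtlas (trans_mem_maximalAtlas he hh hh') hV,
    (hsrc p).2 ⟨hpe, hph, by rw [hh0]; exact Metric.mem_ball_self hρ⟩,
    fixedVectors e 𝓜 p, hW, ?_⟩
  -- After shrinking the chart to the preimage of the ball, the fixed set in it is a continuous
  -- image of the convex set `W ∩ ball 0 ρ`, hence connected.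
  have himage : fixedPoints 𝓜 ∩ (e₁.restrOpen _ hV).source =
      (fun w ↦ e.symm (h.symm w)) '' ((fixedVectors e 𝓜 p : Set (Model n)) ∩ Metric.ball 0 ρ) := by
    ext x
    constructor
    · rintro ⟨hfx, hx⟩
      obtain ⟨hx1, hx2, hx3⟩ := (hsrc x).1 hx
      exact ⟨h (e x), ⟨(hW x hx).1 hfx, hx3⟩, by simp only [h.left_inv hx2, e.left_inv hx1]⟩
    · rintro ⟨w, ⟨hw, hwρ⟩, rfl⟩
      obtain ⟨h1, h2, h3⟩ := hfix w hw hwρ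
      refine ⟨h3, (hsrc _).2 ⟨e.map_target h2, ?_, ?_⟩⟩
      · rw [e.right_inv h2]; exact h.map_target h1
      · rwa [e.right_inv h2, h.right_inv h1]
  rw [himage]
  refine (((fixedVectors e 𝓜 p).convex.inter (convex_ball 0 ρ)).isPreconnected).image _ ?_
  exact e.continuousOn_symm.comp (h.continuousOn_symm.mono fun w hw ↦ (hfix w hw.1 hw.2).1)
    fun w hw ↦ (hfix w hw.1 hw.2).2.1

end SliceCharts

/-! ### Connected components -/

section Components

variable {n : ℕ} {M : Type*} [TopologicalSpace M] [ChartedSpace (Model n) M]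

theorem deriv_mem_of_eventually_mem {W : Submodule ℝ (Model n)} {c : ℝ → Model n} {v : Model n}
    {t : ℝ} (hc : HasDerivAt c v t) (h : ∀ᶠ s in 𝓝 t, c s ∈ W) : v ∈ W := by
  have hclosed : IsClosed (W : Set (Model n)) := W.closed_of_finiteDimensional
  refine hclosed.mem_of_tendsto (hasDerivAt_iff_tendsto_slope.1 hc) ?_
  filter_upwards [h.filter_mono nhdsWithin_le_nhds] with s hs
  exact W.smul_mem _ (W.sub_mem hs h.self_of_nhds)

/-- Slice charts of the same set around the same point have the same dimension. -/
theorem finrank_slice_le {N : Set M} {e e' : OpenPartialHomeomorph M (Model n)}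
    (he : e ∈ IsManifold.maximalAtlas (𝓡 n) ∞ M) (he' : e' ∈ IsManifold.maximalAtlas (𝓡 n) ∞ M)
    {W W' : Submodule ℝ (Model n)} (hW : ∀ x ∈ e.source, x ∈ N ↔ e x ∈ W)
    (hW' : ∀ x ∈ e'.source, x ∈ N ↔ e' x ∈ W') {x : M} (hxN : x ∈ N) (hx : x ∈ e.source)
    (hx' : x ∈ e'.source) : Module.finrank ℝ W ≤ Module.finrank ℝ W' := by
  let ψ := localRep e e' (Diffeomorph.refl (𝓡 n) M ∞)
  have hy : e x ∈ e.target := e.map_source hx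
  have hFy : Diffeomorph.refl (𝓡 n) M ∞ (e.symm (e x)) ∈ e'.source := by
    rw [e.left_inv hx]; exact hx'
  have hψ : DifferentiableAt ℝ ψ (e x) := (contDiffAt_localRep he he' hy hFy).differentiableAt
    (by simp)
  -- The transition map carries lines in `W` through `e x` into `W'` near `e x`, so its derivative,
  -- which is injective, maps `W` into `W'`.
  have hmaps : ∀ w ∈ W, fderiv ℝ ψ (e x) w ∈ W' := by
    intro w hw
    have hline : HasDerivAt (fun t : ℝ ↦ e x + t • w) w 0 := by
      simpa using ((hasDerivAt_id (0 : ℝ)).smul_const w).const_add (e x)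
    have hd : HasDerivAt (fun t : ℝ ↦ ψ (e x + t • w)) (fderiv ℝ ψ (e x) w) 0 :=
      HasFDerivAt.comp_hasDerivAt (f := fun t : ℝ ↦ e x + t • w) (l := ψ) (0 : ℝ)
        (by simpa using hψ.hasFDerivAt) hline
    refine deriv_mem_of_eventually_mem hd ?_
    have hev : ∀ᶠ t : ℝ in 𝓝 0, e x + t • w ∈ e.target ∧
        Diffeomorph.refl (𝓡 n) M ∞ (e.symm (e x + t • w)) ∈ e'.source :=
      by
      have hev' := eventually_localRep e' hy hFy
      rw [show e x = e x + (0 : ℝ) • w by simp] at hev'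
      exact hline.continuousAt.eventually hev'
    filter_upwards [hev] with t ht
    refine (hW' _ ht.2).1 ((hW _ (e.map_target ht.1)).2 ?_)
    rw [e.right_inv ht.1]
    exact W.add_mem ((hW x hx).1 hxN) (W.smul_mem t hw)
  have hinj : Function.Injective
      ((fderiv ℝ ψ (e x)).toLinearMap.restrict (p := W) (q := W') hmaps) := by
    rw [← LinearMap.ker_eq_bot, LinearMap.ker_eq_bot']
    intro w hw
    have h0 : fderiv ℝ ψ (e x) w = 0 := congrArg Subtype.val hw
    have h1 := mfderiv_symm_fderiv_localRep he he' hy hFy (w : Model n)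
    have h2 : (mfderiv (𝓡 n) (𝓡 n) e.symm (e x) (w : Model n) : Model n) = 0 := by
      have h3 : mfderiv (𝓡 n) (𝓡 n) (Diffeomorph.refl (𝓡 n) M ∞) (e.symm (e x)) =
        ContinuousLinearMap.id ℝ _ := mfderiv_id
      rw [h3] at h1
      refine Eq.trans h1.symm ?_
      exact (congrArg (fun v : Model n ↦ (mfderiv (𝓡 n) (𝓡 n) e'.symm _ v : Model n)) h0).trans
        (map_zero _)
    exact Subtype.ext ((mdifferentiable_of_mem_maximalAtlas he).symm.mfderiv_injective
      (x := e x) (by simpa using hy) (h2.trans (map_zero _).symm))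
  exact LinearMap.finrank_le_finrank_of_injective hinj

/-- Slices around a common point have equal dimension, so the dimension is locally constant, hence
constant on the connected set. -/
theorem isEmbeddedSubmanifold_of_isPreconnected [IsManifold (𝓡 n) ∞ M] {N : Set M}
    (hN : IsPreconnected N)
    (h : ∀ p ∈ N, ∃ e ∈ IsManifold.maximalAtlas (𝓡 n) ∞ M, p ∈ e.source ∧
      ∃ W : Submodule ℝ (Model n), ∀ x ∈ e.source, x ∈ N ↔ e x ∈ W) :
    IsEmbeddedSubmanifold (n := n) N := by
  choose e he hpe W hW using fun p : N ↦ h p p.2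
  rcases N.eq_empty_or_nonempty with rfl | ⟨p₀, hp₀⟩
  · exact ⟨0, by simp⟩
  have := isPreconnected_iff_preconnectedSpace.1 hN
  have hloc : IsLocallyConstant fun q : N ↦ Module.finrank ℝ (W q) := by
    rw [IsLocallyConstant.iff_exists_open]
    intro q
    refine ⟨Subtype.val ⁻¹' (e q).source, (e q).open_source.preimage continuous_subtype_val,
      hpe q, fun x hx ↦ le_antisymm ?_ ?_⟩
    · exact finrank_slice_le (he x) (he q) (hW x) (hW q) x.2 (hpe x) hx
    · exact finrank_slice_le (he q) (he x) (hW q) (hW x) x.2 hx (hpe x)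
  exact ⟨Module.finrank ℝ (W ⟨p₀, hp₀⟩), fun p hp ↦ ⟨e ⟨p, hp⟩, he _, hpe _, W ⟨p, hp⟩,
    hloc.apply_eq_of_preconnectedSpace ⟨p, hp⟩ ⟨p₀, hp₀⟩, hW _⟩⟩

/-- Differentiate `F ∘ c = c` at time `0` along a curve `c` of fixed points. -/
theorem mfderiv_apply_of_mem_tangentVectors {N : Set M} {𝓜 : Set (M ≃ₘ⟮𝓡 n, 𝓡 n⟯ M)}
    (hN : N ⊆ fixedPoints 𝓜) {F : M ≃ₘ⟮𝓡 n, 𝓡 n⟯ M} (hF : F ∈ 𝓜) {v : TangentBundle (𝓡 n) M}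
    (hv : v ∈ tangentVectors N) : (mfderiv (𝓡 n) (𝓡 n) F v.1 v.2 : Model n) = v.2 := by
  obtain ⟨c, ε, hε, hc, hcN, rfl⟩ := hv
  have h0 : Ioo (-ε) ε ∈ 𝓝 (0 : ℝ) := Ioo_mem_nhds (by linarith) hε
  have hcd : MDifferentiableAt 𝓘(ℝ, ℝ) (𝓡 n) c 0 :=
    (hc.contMDiffAt h0).mdifferentiableAt (by simp)
  have hFd : MDifferentiableAt (𝓡 n) (𝓡 n) F (c 0) :=
    F.contMDiff.contMDiffAt.mdifferentiableAt (by simp)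
  have hEq : F ∘ c =ᶠ[𝓝 0] c := by
    filter_upwards [h0] with t ht using hN (hcN t ht) F hF
  have h1 : mfderiv 𝓘(ℝ, ℝ) (𝓡 n) (F ∘ c) 0 = _ := mfderiv_comp 0 hFd hcd
  have h2 := hEq.mfderiv_eq (I := 𝓘(ℝ, ℝ)) (I' := 𝓡 n)
  rw [h1] at h2
  exact congrArg (fun L : ℝ →L[ℝ] Model n ↦ L 1) h2

variable [IsManifold (𝓡 n) ∞ M] {S : MagneticSystem n M} {𝓜 : Set (M ≃ₘ⟮𝓡 n, 𝓡 n⟯ M)}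

theorem isTotallyMagnetic_connectedComponentIn [T2Space M] (h𝓜 : 𝓜 ⊆ S.Mag) (p : M) :
    S.IsTotallyMagnetic (connectedComponentIn (fixedPoints 𝓜) p) := by
  -- A connected set of fixed points that meets the component lies in it. It is applied to the fixed
  -- set inside a slice chart and to the image of a magnetic geodesic.
  have hsub : ∀ {K : Set M} {q : M}, q ∈ connectedComponentIn (fixedPoints 𝓜) p →
      IsPreconnected K → q ∈ K → K ⊆ fixedPoints 𝓜 →
      K ⊆ connectedComponentIn (fixedPoints 𝓜) p := by
    intro K q hq hK hqK hKF
    rw [connectedComponentIn_eq hq]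
    exact hK.subset_connectedComponentIn hqK hKF
  refine ⟨isEmbeddedSubmanifold_of_isPreconnected isPreconnected_connectedComponentIn
    fun q hq ↦ ?_, fun γ J hJ hJ' h0 hγ hγ0 hv ↦ ?_⟩
  · have hqF := connectedComponentIn_subset _ _ hq
    obtain ⟨e, he, hqe, W, hW, hconn⟩ := exists_slice_chart h𝓜 hqF
    refine ⟨e, he, hqe, W, fun x hx ↦ ⟨fun hxN ↦
      (hW x hx).1 (connectedComponentIn_subset _ _ hxN), fun hxW ↦ ?_⟩⟩
    exact hsub hq hconn ⟨hqF, hqe⟩ inter_subset_left ⟨(hW x hx).2 hxW, hx⟩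
  · have hcurve := hγ.isMagneticCurveOn hJ
    have hfix : ∀ t ∈ J, γ t ∈ fixedPoints 𝓜 := fun t ht F hF ↦
      hcurve.fixed hJ hJ'.isPreconnected h0 (h𝓜 hF)
        (connectedComponentIn_subset _ _ hγ0 F hF)
        (mfderiv_apply_of_mem_tangentVectors (connectedComponentIn_subset _ _) hF hv) t ht
    have himage : γ '' J ⊆ connectedComponentIn (fixedPoints 𝓜) p :=
      hsub hγ0 (hJ'.isPreconnected.image γ fun t ht ↦
        (hcurve.contMDiffAt t ht).continuousAt.continuousWithinAt) (mem_image_of_mem γ h0)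
        (image_subset_iff.2 hfix)
    obtain ⟨ε, hε, hεJ⟩ := Metric.isOpen_iff.1 hJ 0 h0
    rw [Real.ball_eq_Ioo, zero_sub, zero_add] at hεJ
    exact ⟨ε, hε, hεJ, fun t ht ↦ himage (mem_image_of_mem γ (hεJ ht))⟩

end Components

end

end Magnetic

theorem mainTheorem4 {n : ℕ} {M : Type*} [TopologicalSpace M]
    [ChartedSpace (Magnetic.Model n) M] [IsManifold (𝓡 n) ∞ M]
    [T2Space M] [CompactSpace M] [ConnectedSpace M]
    (S : Magnetic.MagneticSystem n M) (𝓜 : Set (M ≃ₘ⟮𝓡 n, 𝓡 n⟯ M)) (h𝓜 : 𝓜 ⊆ S.Mag) :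
    ∀ p ∈ Magnetic.fixedPoints 𝓜,
      S.IsTotallyMagnetic (connectedComponentIn (Magnetic.fixedPoints 𝓜) p) := fun p _ ↦
  Magnetic.isTotallyMagnetic_connectedComponentIn h𝓜 p
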